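/- Let $M$ be a smooth manifold of dimension $2m$ with a Riemannian metric $g$, let $\nabla$ be the Levi-Civita connection of $g$, and let $F$ be a smooth $(1,1)$-tensor field such that $(M^{2m},F,g)$ is a para-Kähler-Norden manifold: $F^2=\mathrm{Id}$, the eigenbundles of $F$ for $+1$ and $-1$ have the same rank, $g(FX,Y)=g(X,FY)$, and $\nabla F=0$. Let $V$ be a smooth unit vector field on $M$ with $\nabla V=0$, let $\alpha:M\to(0,\infty)$ be smooth with $(FV)(\alpha)=0$, and let $$g^{\alpha}(X,Y)=\alpha\,\bigl(g(X,Y)+g(X,FV)\,g(Y,FV)\bigr).$$ For a smooth map $\varphi:(M,g)\to(N,h)$ between Riemannian manifolds let $\nabla^\varphi$ be the pull-back to $\varphi^{-1}TN$ of the Levi-Civita connection of $h$, let $\tau(\varphi)=\mathrm{Tr}_g\nabla d\varphi$ be the tension field, and let $\tau_2(\varphi)=\Delta^{\varphi}\tau(\varphi)-\mathrm{Tr}_gR^N(\tau(\varphi),d\varphi)d\varphi$ be the bitension field, where $\Delta^{\varphi}=-\mathrm{Tr}_g(\nabla^{\varphi}_*\nabla^{\varphi}_*-\nabla^{\varphi}_{\nabla_**})$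 and $R^N(X,Y)Z=\nabla^N_X\nabla^N_YZ-\nabla^N_Y\nabla^N_XZ-\nabla^N_{[X,Y]}Z$. The map $\varphi$ is harmonic if $\tau(\varphi)=0$, biharmonic if $\tau_2(\varphi)=0$, and proper biharmonic if it is biharmonic and not harmonic. Define the vector field $$B=\Delta^{I}\mathrm{grad}\,\alpha-\mathrm{Ricci}(\mathrm{grad}\,\alpha)+\frac{2m-1}{2\alpha}\nabla_{\mathrm{grad}\,\alpha}\mathrm{grad}\,\alpha-\Bigl(\frac{(2m+3)\|\mathrm{grad}\,\alpha\|^2}{4\alpha^2}-\frac{2\Delta(\alpha)}{\alpha}\Bigr)\mathrm{grad}\,\alpha-\nabla_{FV}\nabla_{FV}\mathrm{grad}\,\alpha ,$$ in which everything is taken with respect to $g$: $\Delta^{I}X=-\mathrm{Tr}_g(\nabla_*\nabla_*-\nabla_{\nabla_**})X$, $\mathrm{Ricci}(X)=\sum_iR(X,e_i)e_i$ and $\Delta(\alpha)=\sum_ig(\nabla_{e_i}\mathrm{grad}\,\alpha,e_i)$ for a local $g$-orthonormal frame $(e_i)$. Then for the identity map $I:(M,g)\to(M,g^{\alpha})$: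 1. $\displaystyle\tau_2(I)=\frac{1-2m}{2\alpha}\,B$. 2. $I$ is biharmonic if and only if $B=0$ on $M$. 3. If $M$ is connected, then $I$ is proper biharmonic if and only if $\alpha$ is not constant on $M$ and $B=0$ on $M$. -/

import Mathlib

open scoped Manifold ContDiff

noncomputable section

namespace BergerBiharmonic

open Bundle (TotalSpace RiemannianBundle ContMDiffRiemannianMetric)

/-- The model space `ℝⁿ` with its Euclidean norm. -/
abbrev Model (n : ℕ) : Type := EuclideanSpace ℝ (Fin n)

/-- Vector fields on `M`: sections of the tangent bundle (no regularity is imposed here). -/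
abbrev VField (n : ℕ) (M : Type*) [TopologicalSpace M] [ChartedSpace (Model n) M] :=
  (x : M) → TangentSpace (𝓡 n) x

/-- `(1,1)`-tensor fields on `M` (no regularity is imposed here). -/
abbrev Tensor11 (n : ℕ) (M : Type*) [TopologicalSpace M] [ChartedSpace (Model n) M] :=
  (x : M) → TangentSpace (𝓡 n) x →L[ℝ] TangentSpace (𝓡 n) x

/-- Smooth Riemannian metrics on an `n`-dimensional smooth manifold `M`. -/
abbrev Metric (n : ℕ) (M : Type*) [TopologicalSpace M] [ChartedSpace (Model n) M]
    [IsManifold (𝓡 n) ∞ M] :=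
  ContMDiffRiemannianMetric (𝓡 n) ∞ (Model n) (fun x : M => TangentSpace (𝓡 n) x)

/-- A vector field is smooth: it is a smooth section of `TM`. -/
def IsSmoothField {n : ℕ} {M : Type*} [TopologicalSpace M] [ChartedSpace (Model n) M]
    [IsManifold (𝓡 n) ∞ M] (X : VField n M) : Prop :=
  ContMDiff (𝓡 n) ((𝓡 n).prod 𝓘(ℝ, Model n)) ∞
    (fun x => TotalSpace.mk' (Model n) (E := fun x : M => TangentSpace (𝓡 n) x) x (X x))

/-- A `(1,1)`-tensor field is smooth: it is a smooth section of `Hom(TM, TM)`. -/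
def IsSmoothTensor11 {n : ℕ} {M : Type*} [TopologicalSpace M] [ChartedSpace (Model n) M]
    [IsManifold (𝓡 n) ∞ M] (F : Tensor11 n M) : Prop :=
  ContMDiff (𝓡 n) ((𝓡 n).prod 𝓘(ℝ, Model n →L[ℝ] Model n)) ∞
    (fun x => TotalSpace.mk' (Model n →L[ℝ] Model n)
      (E := fun x : M => TangentSpace (𝓡 n) x →L[ℝ] TangentSpace (𝓡 n) x) x (F x))

section Metric

variable {n : ℕ} {M : Type*} [TopologicalSpace M] [ChartedSpace (Model n) M]
  [IsManifold (𝓡 n) ∞ M]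

open scoped Bundle in
/-- Every tangent space has a `g`-orthonormal basis. -/
theorem exists_orthonormal_basis (g : Metric n M) (x : M) :
    ∃ b : Module.Basis (Fin n) ℝ (TangentSpace (𝓡 n) x),
      ∀ i j, g.inner x (b i) (b j) = if i = j then 1 else 0 := by
  let _ : RiemannianBundle (fun x : M => TangentSpace (𝓡 n) x) := ⟨g.toRiemannianMetric⟩
  have hfd : FiniteDimensional ℝ (TangentSpace (𝓡 n) x) :=
    inferInstanceAs (FiniteDimensional ℝ (Model n))
  have hd : Module.finrank ℝ (TangentSpace (𝓡 n) x) = n :=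
    (finrank_euclideanSpace_fin (𝕜 := ℝ) (n := n) :)
  let b := (stdOrthonormalBasis ℝ (TangentSpace (𝓡 n) x)).reindex (finCongr hd)
  refine ⟨b.toBasis, fun i j => ?_⟩
  have h := orthonormal_iff_ite.mp b.orthonormal i j
  rw [← h]
  simp only [OrthonormalBasis.coe_toBasis]
  rfl

/-- A `g`-orthonormal basis `e₁, …, eₙ` of `T_x M`.  It is only used to form sums that do not
depend on which orthonormal basis is taken (traces with respect to `g`, and duality). -/
def onb (g : Metric n M) (x : M) : Module.Basis (Fin n) ℝ (TangentSpace (𝓡 n) x) :=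
  (exists_orthonormal_basis g x).choose

theorem onb_spec (g : Metric n M) (x : M) (i j : Fin n) :
    g.inner x (onb g x i) (onb g x j) = if i = j then 1 else 0 :=
  (exists_orthonormal_basis g x).choose_spec i j

/-- The local vector field extending a tangent vector `u ∈ T_x M` with constant components in the
preferred chart at `x`; it is smooth near `x`. -/
def extField {x : M} (u : TangentSpace (𝓡 n) x) : VField n M :=
  FiberBundle.extend (Model n) u

/-- `X(f)` at `x`, for a tangent vector `X ∈ T_x M`. -/
def dirDeriv (f : M → ℝ) (x : M) (u : TangentSpace (𝓡 n) x) : ℝ :=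
  mvfderiv (𝓡 n) f x u

/-- The right-hand side of the Koszul formula:
`X g(Y,Z) + Y g(Z,X) - Z g(X,Y) + g([X,Y],Z) - g([X,Z],Y) - g([Y,Z],X)`. -/
def koszul (g : Metric n M) (X Y Z : VField n M) (x : M) : ℝ :=
  dirDeriv (fun y => g.inner y (Y y) (Z y)) x (X x)
    + dirDeriv (fun y => g.inner y (Z y) (X y)) x (Y x)
    - dirDeriv (fun y => g.inner y (X y) (Y y)) x (Z x)
    + g.inner x (VectorField.mlieBracket (𝓡 n) X Y x) (Z x)
    - g.inner x (VectorField.mlieBracket (𝓡 n) X Z x) (Y x)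
    - g.inner x (VectorField.mlieBracket (𝓡 n) Y Z x) (X x)

/-- The Levi-Civita connection of `g`: for `u ∈ T_x M` and a vector field `Y`, `nabla g u Y` is
`(∇_u Y)(x)`, the vector with `2 g(∇_u Y, w) = koszul g X Y Z x` for `X`, `Z` extending `u`, `w`;
it is written out in a `g`-orthonormal basis of `T_x M`. -/
def nabla (g : Metric n M) {x : M} (u : TangentSpace (𝓡 n) x) (Y : VField n M) :
    TangentSpace (𝓡 n) x :=
  ∑ i, ((1 / 2 : ℝ) * koszul g (extField u) Y (extField (onb g x i)) x) • onb g x i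

/-- The curvature tensor `R(u,v)w = ∇_u ∇_v w - ∇_v ∇_u w - ∇_{[u,v]} w` at `x`, computed with
local extensions of the three tangent vectors. -/
def curvature (g : Metric n M) {x : M} (u v w : TangentSpace (𝓡 n) x) :
    TangentSpace (𝓡 n) x :=
  nabla g u (fun y => nabla g (extField v y) (extField w))
    - nabla g v (fun y => nabla g (extField u y) (extField w))
    - nabla g (VectorField.mlieBracket (𝓡 n) (extField u) (extField v) x) (extField w)

/-- The Ricci tensor as an endomorphism, `Ricci(u) = ∑ R(u, eᵢ) eᵢ`. -/
def ricci (g : Metric n M) {x : M} (u : TangentSpace (𝓡 n) x) : TangentSpace (𝓡 n) x :=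
  ∑ i, curvature g u (onb g x i) (onb g x i)

/-- The gradient `grad f = ∑ eᵢ(f) eᵢ`. -/
def grad (g : Metric n M) (f : M → ℝ) : VField n M := fun x =>
  ∑ i, dirDeriv f x (onb g x i) • onb g x i

/-- The Laplacian `Δ(f) = ∑ g(∇_{eᵢ} grad f, eᵢ)` on functions. -/
def laplacian (g : Metric n M) (f : M → ℝ) (x : M) : ℝ :=
  ∑ i, g.inner x (nabla g (onb g x i) (grad g f)) (onb g x i)

/-- `‖grad f‖²`, the norm being that of `g`. -/
def gradNormSq (g : Metric n M) (f : M → ℝ) (x : M) : ℝ :=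
  g.inner x (grad g f x) (grad g f x)

/-- The rough Laplacian `-Tr_g(∇_* ∇_* - ∇_{∇_* *}) X` on vector fields. -/
def roughLaplacian (g : Metric n M) (X : VField n M) : VField n M := fun x =>
  -∑ i, (nabla g (onb g x i) (fun y => nabla g (extField (onb g x i) y) X)
      - nabla g (nabla g (onb g x i) (extField (onb g x i))) X)

/-- `(F, g)` is an almost para-complex Norden structure with `∇F = 0`: `F² = I`, the eigenbundles
of `F` for `+1` and `-1` have the same rank, `g(FX, Y) = g(X, FY)`, and `∇_X (FY) = F(∇_X Y)`. -/
structure IsParaKahlerNorden (g : Metric n M) (F : Tensor11 n M) : Prop where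
  smooth : IsSmoothTensor11 F
  sq : ∀ (x : M) (u : TangentSpace (𝓡 n) x), F x (F x u) = u
  rank_eq : ∀ x : M,
    Module.finrank ℝ (Module.End.eigenspace (F x).toLinearMap (1 : ℝ))
      = Module.finrank ℝ (Module.End.eigenspace (F x).toLinearMap (-1 : ℝ))
  pure : ∀ (x : M) (u v : TangentSpace (𝓡 n) x), g.inner x (F x u) v = g.inner x u (F x v)
  parallel : ∀ (Y : VField n M) (x : M) (u : TangentSpace (𝓡 n) x),
    MDifferentiableAt (𝓡 n) ((𝓡 n).prod 𝓘(ℝ, Model n))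
      (fun y => TotalSpace.mk' (Model n) (E := fun y : M => TangentSpace (𝓡 n) y) y (Y y)) x →
    nabla g u (fun y => F y (Y y)) = F x (nabla g u Y)

/-- The vector field `FV`. -/
def applyField (F : Tensor11 n M) (V : VField n M) : VField n M := fun x => F x (V x)

/-- `V` is a unit vector field that is parallel for the Levi-Civita connection of `g`. -/
structure IsUnitParallel (g : Metric n M) (V : VField n M) : Prop where
  unit : ∀ x : M, g.inner x (V x) (V x) = 1
  parallel : ∀ (x : M) (u : TangentSpace (𝓡 n) x), nabla g u V = 0

end Metric

section Berger

variable {n : ℕ} {M : Type*} [TopologicalSpace M] [ChartedSpace (Model n) M]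
  [IsManifold (𝓡 n) ∞ M]

/-- The bilinear form `α (g(X,Y) + g(X,W) g(Y,W))` on `T_x M`. -/
def bergerForm (g : Metric n M) (W : VField n M) (α : M → ℝ) (x : M) :
    TangentSpace (𝓡 n) x →L[ℝ] TangentSpace (𝓡 n) x →L[ℝ] ℝ :=
  α x • (g.inner x + (g.inner x (W x)).smulRight (g.inner x (W x)))

theorem bergerForm_apply (g : Metric n M) (W : VField n M) (α : M → ℝ) (x : M)
    (u v : TangentSpace (𝓡 n) x) :
    bergerForm g W α x u v
      = α x * (g.inner x u v + g.inner x u (W x) * g.inner x v (W x)) := by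
  rw [g.symm x u (W x), g.symm x v (W x)]
  rfl

theorem contDiff_rankOne (E : Type*) [NormedAddCommGroup E] [NormedSpace ℝ E] :
    ContDiff ℝ ∞ (fun c : E →L[ℝ] ℝ => c.smulRight c) := by
  exact contDiff_id.smulRight contDiff_id

theorem contMDiff_rankOne (g : Metric n M) (W : VField n M) (hW : IsSmoothField W) :
    ContMDiff (𝓡 n) ((𝓡 n).prod 𝓘(ℝ, Model n →L[ℝ] Model n →L[ℝ] ℝ)) ∞
      (fun x => TotalSpace.mk' (Model n →L[ℝ] Model n →L[ℝ] ℝ)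
        (E := fun x : M => TangentSpace (𝓡 n) x →L[ℝ] TangentSpace (𝓡 n) x →L[ℝ] ℝ)
        x ((g.inner x (W x)).smulRight (g.inner x (W x)))) := by
  intro x₀
  have h1 := (g.contMDiff.clm_bundle_apply hW) x₀
  have h2 := ((contMDiffAt_hom_bundle (E₂ := fun _ : M => ℝ) _).mp h1).2
  refine (contMDiffAt_hom_bundle _).mpr ⟨contMDiffAt_id, ?_⟩
  have h3 := (contDiff_rankOne (Model n)).contMDiff.contMDiffAt.comp x₀ h2
  refine h3.congr_of_eventuallyEq ?_
  filter_upwards [(trivializationAt (Model n) (fun x : M => TangentSpace (𝓡 n) x)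
    x₀).open_baseSet.mem_nhds (FiberBundle.mem_baseSet_trivializationAt' x₀)] with y hy
  ext v w
  rw [inCoordinates_apply_eq₂ hy hy (Set.mem_univ _)]
  have hs := fun v => Bundle.Trivialization.symmL_apply (R := ℝ)
    (trivializationAt (Model n) (fun x : M => TangentSpace (𝓡 n) x) x₀) hy v
  simp [ContinuousLinearMap.inCoordinates]
  congr 1 <;> (congr 1; exact (hs _).symm)

theorem contMDiff_bergerForm (g : Metric n M) (W : VField n M) (α : M → ℝ)
    (hW : IsSmoothField W) (hα : ContMDiff (𝓡 n) 𝓘(ℝ, ℝ) ∞ α) :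
    ContMDiff (𝓡 n) ((𝓡 n).prod 𝓘(ℝ, Model n →L[ℝ] Model n →L[ℝ] ℝ)) ∞
      (fun x => TotalSpace.mk' (Model n →L[ℝ] Model n →L[ℝ] ℝ)
        (E := fun x : M => TangentSpace (𝓡 n) x →L[ℝ] TangentSpace (𝓡 n) x →L[ℝ] ℝ)
        x (bergerForm g W α x)) :=
  hα.smul_section (g.contMDiff.add_section (contMDiff_rankOne g W hW))

/-- The conformal deformation of Berger type
`g^α(X,Y) = α (g(X,Y) + g(X,FV) g(Y,FV))`, as a smooth Riemannian metric. -/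
def bergerMetric (g : Metric n M) (F : Tensor11 n M) (V : VField n M) (α : M → ℝ)
    (hF : IsSmoothTensor11 F) (hV : IsSmoothField V)
    (hα : ContMDiff (𝓡 n) 𝓘(ℝ, ℝ) ∞ α) (hpos : ∀ x, 0 < α x) : Metric n M where
  inner := bergerForm g (applyField F V) α
  symm x u v := by
    rw [bergerForm_apply, bergerForm_apply, g.symm x u v]
    ring
  pos x u hu := by
    rw [bergerForm_apply]
    have := g.pos x u hu
    have := mul_self_nonneg (g.inner x u (applyField F V x))
    exact mul_pos (hpos x) (by linarith)
  isVonNBounded x := by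
    refine ((g.isVonNBounded x).image ((Real.sqrt (α x))⁻¹ •
      ContinuousLinearMap.id ℝ (TangentSpace (𝓡 n) x))).subset ?_
    intro u hu
    have hs : 0 < Real.sqrt (α x) := Real.sqrt_pos.mpr (hpos x)
    refine ⟨Real.sqrt (α x) • u, ?_, ?_⟩
    · simp only [Set.mem_ofPred_eq, bergerForm_apply] at hu ⊢
      have := mul_self_nonneg (g.inner x u (applyField F V x))
      have h2 := Real.mul_self_sqrt (hpos x).le
      have h3 : g.inner x (Real.sqrt (α x) • u) (Real.sqrt (α x) • u)
          = α x * g.inner x u u := by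
        simp only [map_smul, smul_apply, smul_eq_mul]
        rw [← mul_assoc, h2]
      rw [h3]
      nlinarith [hpos x, mul_nonneg (hpos x).le this]
    · simp [smul_smul, hs.ne']
  contMDiff := contMDiff_bergerForm g _ α (hF.clm_bundle_apply hV) hα

end Berger

section Maps

variable {n k : ℕ} {M N : Type*} [TopologicalSpace M] [ChartedSpace (Model n) M]
  [IsManifold (𝓡 n) ∞ M] [TopologicalSpace N] [ChartedSpace (Model k) N]
  [IsManifold (𝓡 k) ∞ N]

/-- Sections of the pull-back bundle `φ⁻¹TN`, that is, vector fields along `φ : M → N`. -/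
abbrev FieldAlong (k : ℕ) {M N : Type*} [TopologicalSpace N] [ChartedSpace (Model k) N]
    (φ : M → N) :=
  (x : M) → TangentSpace (𝓡 k) (φ x)

/-- The components of a vector field `s` along `φ` in the preferred chart of `N` at `φ x`. -/
def components (φ : M → N) (s : FieldAlong k φ) (x : M) (y : M) : Model k :=
  (trivializationAt (Model k) (fun p : N => TangentSpace (𝓡 k) p) (φ x) ⟨φ y, s y⟩).2

/-- The pull-back connection `∇^φ` on `φ⁻¹TN` of the Levi-Civita connection of `h`.  If
`s = ∑ sᵃ (∂ₐ ∘ φ)` near `x`, with `∂ₐ` the coordinate fields of the preferred chart at `φ x`, then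
`∇^φ_u s = ∑ u(sᵃ) ∂ₐ + ∇^N_{dφ(u)} (∑ sᵃ(x) ∂ₐ)` at `x`. -/
def pullbackNabla (h : Metric k N) (φ : M → N) {x : M} (u : TangentSpace (𝓡 n) x)
    (s : FieldAlong k φ) : TangentSpace (𝓡 k) (φ x) :=
  (trivializationAt (Model k) (fun p : N => TangentSpace (𝓡 k) p) (φ x)).symm (φ x)
      (mvfderiv (𝓡 n) (components φ s x) x u)
    + nabla h (mfderiv (𝓡 n) (𝓡 k) φ x u) (extField (s x))

/-- The tension field `τ(φ) = Tr_g ∇dφ = ∑ (∇^φ_{eᵢ} dφ(eᵢ) - dφ(∇_{eᵢ} eᵢ))`. -/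
def tension (g : Metric n M) (h : Metric k N) (φ : M → N) : FieldAlong k φ := fun x =>
  ∑ i, (pullbackNabla h φ (onb g x i) (fun y => mfderiv (𝓡 n) (𝓡 k) φ y (extField (onb g x i) y))
      - mfderiv (𝓡 n) (𝓡 k) φ x (nabla g (onb g x i) (extField (onb g x i))))

/-- The rough Laplacian `Δ^φ s = -Tr_g (∇^φ_* ∇^φ_* - ∇^φ_{∇_* *}) s` on `φ⁻¹TN`. -/
def roughLaplacianAlong (g : Metric n M) (h : Metric k N) (φ : M → N) (s : FieldAlong k φ) :
    FieldAlong k φ := fun x =>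
  -∑ i, (pullbackNabla h φ (onb g x i) (fun y => pullbackNabla h φ (extField (onb g x i) y) s)
      - pullbackNabla h φ (nabla g (onb g x i) (extField (onb g x i))) s)

/-- The bitension field `τ₂(φ) = Δ^φ τ(φ) - Tr_g R^N(τ(φ), dφ) dφ`. -/
def bitension (g : Metric n M) (h : Metric k N) (φ : M → N) : FieldAlong k φ := fun x =>
  roughLaplacianAlong g h φ (tension g h φ) x
    - ∑ i, curvature h (tension g h φ x) (mfderiv (𝓡 n) (𝓡 k) φ x (onb g x i))
        (mfderiv (𝓡 n) (𝓡 k) φ x (onb g x i))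

/-- `φ : (M, g) → (N, h)` is a harmonic map. -/
def IsHarmonic (g : Metric n M) (h : Metric k N) (φ : M → N) : Prop :=
  ContMDiff (𝓡 n) (𝓡 k) ∞ φ ∧ ∀ x, tension g h φ x = 0

/-- `φ : (M, g) → (N, h)` is a biharmonic map. -/
def IsBiharmonic (g : Metric n M) (h : Metric k N) (φ : M → N) : Prop :=
  ContMDiff (𝓡 n) (𝓡 k) ∞ φ ∧ ∀ x, bitension g h φ x = 0

/-- A proper biharmonic map: biharmonic but not harmonic. -/
def IsProperBiharmonic (g : Metric n M) (h : Metric k N) (φ : M → N) : Prop :=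
  IsBiharmonic g h φ ∧ ¬ IsHarmonic g h φ

end Maps

/-- The bracketed vector field, in terms of `(M, F, g)`, `V` and `α` only (`dim M = 2m`):
`Δ^I grad α - Ricci(grad α) + (2m-1)/(2α) ∇_{grad α} grad α
  - ((2m+3)‖grad α‖²/(4α²) - 2Δ(α)/α) grad α - ∇_{FV} ∇_{FV} grad α`. -/
def bitensionBracket {m : ℕ} {M : Type*} [TopologicalSpace M] [ChartedSpace (Model (2 * m)) M]
    [IsManifold (𝓡 (2 * m)) ∞ M] (g : Metric (2 * m) M) (F : Tensor11 (2 * m) M)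
    (V : VField (2 * m) M) (α : M → ℝ) : VField (2 * m) M := fun x =>
  roughLaplacian g (grad g α) x
    - ricci g (grad g α x)
    + ((2 * (m : ℝ) - 1) / (2 * α x)) • nabla g (grad g α x) (grad g α)
    - ((2 * (m : ℝ) + 3) * gradNormSq g α x / (4 * α x ^ 2) - 2 * laplacian g α x / α x)
        • grad g α x
    - nabla g (applyField F V x) (fun y => nabla g (applyField F V y) (grad g α))

end BergerBiharmonic

end

/-! Put W = FV and φ = (log α)/2. Purity of F and F² = Id give g(W,W) = g(V,V) = 1; parallelism of F
and V gives ∇W = 0; and Wφ = 0 by hypothesis. So the target metric is h = e^{2φ}(g + W^♭ ⊗ W^♭).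
Since W^♭ is parallel, g + W^♭ ⊗ W^♭ has the Levi-Civita connection of g, and since Wφ = 0 the
gradient of φ is the same for both metrics. Hence the classical conformal formulas for the
connection and the curvature hold with g + W^♭ ⊗ W^♭ in the place of g (`nabla_eq`, `curvature_eq`).

All traces are taken with respect to g, where g + W^♭ ⊗ W^♭ has trace n + 1. With n = dim M this
gives τ(I) = 2 grad φ - (n+1) grad φ = (1-n) grad φ (`tension_eq`), and the traces of the second
derivative and of the curvature give τ₂(I) in terms of φ (`bitension_eq`). Substituting grad φ =
grad α / (2α) yields B (`bitension_eq_bitensionBracket`); its last term vanishes, because Hess α(FV,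
·) is the derivative of the zero function (FV)(α).

The number 1 - 2m is odd, hence nonzero, so τ₂(I) and B vanish together, and so do τ(I) and grad α.
On a connected manifold the latter means that α is constant.

Before this, the Koszul expression defining `nabla` must be shown to yield the Levi-Civita
connection, and to preserve smoothness (`inner_nabla`, `smoothNear_nabla`); and the pull-back
connection along the identity must be identified with `nabla` (`pullbackNabla_id`). -/

noncomputable section

namespace BergerBiharmonic

open Bundle Filter Topology VectorField

/-! ### Calculus of functions and fields smooth on a neighbourhood, a notion stable under
differentiation. -/

section Calculus

variable {n : ℕ} {M : Type*} [TopologicalSpace M] [ChartedSpace (Model n) M]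

/-- The function `f` is smooth in a neighbourhood of `x`. -/
def SmoothFnNear (f : M → ℝ) (x : M) : Prop := ∀ᶠ y in 𝓝 x, ContMDiffAt (𝓡 n) 𝓘(ℝ, ℝ) ∞ f y

theorem SmoothFnNear.eventually {f : M → ℝ} {x : M} (h : SmoothFnNear (n := n) f x) :
    ∀ᶠ y in 𝓝 x, SmoothFnNear (n := n) f y := h.eventually_nhds

theorem SmoothFnNear.mdiff {f : M → ℝ} {x : M} (h : SmoothFnNear (n := n) f x) :
    MDifferentiableAt (𝓡 n) 𝓘(ℝ, ℝ) f x :=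
  h.self_of_nhds.mdifferentiableAt (by simp)

theorem SmoothFnNear.congr {f f' : M → ℝ} {x : M} (h : SmoothFnNear (n := n) f x)
    (e : ∀ᶠ y in 𝓝 x, f' y = f y) : SmoothFnNear (n := n) f' x := by
  filter_upwards [h, e.eventually_nhds] with y hy ey
  exact ContMDiffAt.congr_of_eventuallyEq hy ey

theorem smoothFnNear_of_contMDiff {f : M → ℝ} (h : ContMDiff (𝓡 n) 𝓘(ℝ, ℝ) ∞ f) (x : M) :
    SmoothFnNear (n := n) f x := Eventually.of_forall fun y => h y

theorem SmoothFnNear.const (c : ℝ) (x : M) : SmoothFnNear (n := n) (fun _ => c) x :=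
  Eventually.of_forall fun _ => contMDiffAt_const

theorem SmoothFnNear.add {f f' : M → ℝ} {x : M} (hf : SmoothFnNear (n := n) f x)
    (hf' : SmoothFnNear (n := n) f' x) : SmoothFnNear (n := n) (fun y => f y + f' y) x := by
  filter_upwards [hf, hf'] with y h1 h2
  exact ContMDiffAt.add h1 h2

theorem SmoothFnNear.sub {f f' : M → ℝ} {x : M} (hf : SmoothFnNear (n := n) f x)
    (hf' : SmoothFnNear (n := n) f' x) : SmoothFnNear (n := n) (fun y => f y - f' y) x := by
  filter_upwards [hf, hf'] with y h1 h2
  exact ContMDiffAt.sub h1 h2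

theorem SmoothFnNear.mul {f f' : M → ℝ} {x : M} (hf : SmoothFnNear (n := n) f x)
    (hf' : SmoothFnNear (n := n) f' x) : SmoothFnNear (n := n) (fun y => f y * f' y) x := by
  filter_upwards [hf, hf'] with y h1 h2
  exact ContMDiffAt.mul h1 h2

theorem SmoothFnNear.comp {f : M → ℝ} {x : M} (hf : SmoothFnNear (n := n) f x) {k : ℝ → ℝ}
    (hk : ∀ᶠ y in 𝓝 x, ContDiffAt ℝ ∞ k (f y)) :
    SmoothFnNear (n := n) (fun y => k (f y)) x := by
  filter_upwards [hf, hk] with y h1 h2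
  exact ContMDiffAt.comp y h2.contMDiffAt h1

theorem dirDeriv_add {f f' : M → ℝ} {x : M} (hf : MDifferentiableAt (𝓡 n) 𝓘(ℝ, ℝ) f x)
    (hf' : MDifferentiableAt (𝓡 n) 𝓘(ℝ, ℝ) f' x) (u : TangentSpace (𝓡 n) x) :
    dirDeriv (fun y => f y + f' y) x u = dirDeriv f x u + dirDeriv f' x u := by
  simp only [dirDeriv, mvfderiv_fun_add hf hf']; rfl

theorem dirDeriv_mul {f f' : M → ℝ} {x : M} (hf : MDifferentiableAt (𝓡 n) 𝓘(ℝ, ℝ) f x)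
    (hf' : MDifferentiableAt (𝓡 n) 𝓘(ℝ, ℝ) f' x) (u : TangentSpace (𝓡 n) x) :
    dirDeriv (fun y => f y * f' y) x u = f x * dirDeriv f' x u + f' x * dirDeriv f x u := by
  simp only [dirDeriv, mvfderiv_fun_mul hf hf']; rfl

@[simp] theorem dirDeriv_const (c : ℝ) (x : M) (u : TangentSpace (𝓡 n) x) :
    dirDeriv (fun _ => c) x u = 0 := by
  simp only [dirDeriv, mvfderiv_const]; rfl

theorem dirDeriv_congr {f f' : M → ℝ} {x : M} (h : ∀ᶠ y in 𝓝 x, f y = f' y)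
    (u : TangentSpace (𝓡 n) x) : dirDeriv f x u = dirDeriv f' x u := by
  have h' : f =ᶠ[𝓝 x] f' := h
  simp only [dirDeriv, mvfderiv, ContinuousLinearMap.comp_apply, h'.mfderiv_eq]
  rfl

@[simp] theorem dirDeriv_vadd (f : M → ℝ) (x : M) (u v : TangentSpace (𝓡 n) x) :
    dirDeriv f x (u + v) = dirDeriv f x u + dirDeriv f x v := map_add _ _ _

@[simp] theorem dirDeriv_vsub (f : M → ℝ) (x : M) (u v : TangentSpace (𝓡 n) x) :
    dirDeriv f x (u - v) = dirDeriv f x u - dirDeriv f x v := map_sub _ _ _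

@[simp] theorem dirDeriv_vsmul (f : M → ℝ) (x : M) (c : ℝ) (u : TangentSpace (𝓡 n) x) :
    dirDeriv f x (c • u) = c * dirDeriv f x u := map_smul _ _ _

@[simp] theorem dirDeriv_vzero (f : M → ℝ) (x : M) :
    dirDeriv f x (0 : TangentSpace (𝓡 n) x) = 0 := map_zero _

theorem dirDeriv_comp {f : M → ℝ} {x : M} (hf : MDifferentiableAt (𝓡 n) 𝓘(ℝ, ℝ) f x) {k : ℝ → ℝ}
    {k' : ℝ} (hk : HasDerivAt k k' (f x)) (u : TangentSpace (𝓡 n) x) :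
    dirDeriv (fun y => k (f y)) x u = k' * dirDeriv f x u := by
  have h1 := (hk.hasFDerivAt.hasMFDerivAt.comp x hf.hasMFDerivAt).mfderiv
  simp only [dirDeriv, mvfderiv]
  change (mfderiv (𝓡 n) 𝓘(ℝ, ℝ) (k ∘ f) x) u = _
  rw [h1]
  exact mul_comm (dirDeriv f x u) k'

variable [IsManifold (𝓡 n) ∞ M]

/-- The vector field `X` is smooth at `x`. -/
def SmoothFieldAt (X : VField n M) (x : M) : Prop :=
  ContMDiffAt (𝓡 n) ((𝓡 n).prod 𝓘(ℝ, Model n)) ∞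
    (fun x => TotalSpace.mk' (Model n) (E := fun x : M => TangentSpace (𝓡 n) x) x (X x)) x

/-- The vector field `X` is smooth in a neighbourhood of `x`. -/
def SmoothNear (X : VField n M) (x : M) : Prop := ∀ᶠ y in 𝓝 x, SmoothFieldAt X y

theorem SmoothNear.smoothFieldAt {X : VField n M} {x : M} (h : SmoothNear X x) :
    SmoothFieldAt X x := h.self_of_nhds

theorem SmoothNear.eventually {X : VField n M} {x : M} (h : SmoothNear X x) :
    ∀ᶠ y in 𝓝 x, SmoothNear X y := h.eventually_nhds

theorem SmoothNear.mdiff {X : VField n M} {x : M} (h : SmoothNear X x) :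
    MDifferentiableAt (𝓡 n) ((𝓡 n).prod 𝓘(ℝ, Model n))
      (fun x => TotalSpace.mk' (Model n) (E := fun x : M => TangentSpace (𝓡 n) x) x (X x)) x :=
  h.smoothFieldAt.mdifferentiableAt (by simp)

theorem SmoothNear.congr {X Y : VField n M} {x : M} (h : SmoothNear X x)
    (e : ∀ᶠ y in 𝓝 x, Y y = X y) : SmoothNear Y x := by
  filter_upwards [h, e.eventually_nhds] with y hy ey
  refine ContMDiffAt.congr_of_eventuallyEq hy ?_
  filter_upwards [ey] with z hz
  rw [hz]

theorem IsSmoothField.smoothNear {X : VField n M} (h : IsSmoothField X) (x : M) :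
    SmoothNear X x := Eventually.of_forall fun y => h y

theorem SmoothNear.add {X Y : VField n M} {x : M} (hX : SmoothNear X x) (hY : SmoothNear Y x) :
    SmoothNear (fun y => X y + Y y) x := by
  filter_upwards [hX, hY] with y h1 h2
  exact ContMDiffAt.add_section h1 h2

theorem SmoothNear.smul {f : M → ℝ} {X : VField n M} {x : M} (hf : SmoothFnNear (n := n) f x)
    (hX : SmoothNear X x) : SmoothNear (fun y => f y • X y) x := by
  filter_upwards [hf, hX] with y h1 h2
  exact ContMDiffAt.smul_section h1 h2

theorem SmoothNear.const_smul {X : VField n M} {x : M} (c : ℝ)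
    (hX : SmoothNear X x) : SmoothNear (fun y => c • X y) x := by
  filter_upwards [hX] with y h2
  exact ContMDiffAt.const_smul_section h2

theorem SmoothNear.sum {ι : Type*} {s : Finset ι} {X : ι → VField n M} {x : M}
    (hX : ∀ i ∈ s, SmoothNear (X i) x) : SmoothNear (fun y => ∑ i ∈ s, X i y) x := by
  have : ∀ᶠ y in 𝓝 x, ∀ i ∈ s, SmoothFieldAt (X i) y := by
    rw [Filter.eventually_all_finset]
    exact hX
  filter_upwards [this] with y h2
  exact ContMDiffAt.sum_section h2

theorem smoothNear_extField {x : M} (u : TangentSpace (𝓡 n) x) : SmoothNear (extField u) x := by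
  obtain ⟨s, hs, h⟩ := FiberBundle.exists_contMDiffOn_extend (k := ∞) (𝓡 n) (Model n)
    (V := fun x : M => TangentSpace (𝓡 n) x) u
  filter_upwards [eventually_mem_nhds_iff.mpr hs] with y hy
  exact h.contMDiffAt hy

@[simp] theorem extField_self {x : M} (u : TangentSpace (𝓡 n) x) : extField u x = u :=
  FiberBundle.extend_apply_self _ u

theorem smoothFnNear_dirDeriv {f : M → ℝ} {X : VField n M} {x : M}
    (hf : SmoothFnNear (n := n) f x) (hX : SmoothNear X x) :
    SmoothFnNear (n := n) (fun y => dirDeriv f y (X y)) x := by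
  filter_upwards [hf, hX] with y h1 h2
  have h3 := ContMDiffAt.mfderiv_const (m := ∞) h1 (by simp)
  have h4 := ContMDiffAt.clm_apply_of_inCoordinates (ϕ := fun y => mfderiv (𝓡 n) 𝓘(ℝ, ℝ) f y)
    (b₁ := id) (b₂ := f) h3 h2 h1
  exact ((contMDiff_snd_tangentBundle_modelSpace ℝ 𝓘(ℝ, ℝ)).contMDiffAt.comp y h4 :)

theorem SmoothNear.mlieBracket {X Y : VField n M} {x : M} (hX : SmoothNear X x)
    (hY : SmoothNear Y x) : SmoothNear (mlieBracket (𝓡 n) X Y) x := by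
  filter_upwards [hX, hY] with y h1 h2
  have : IsManifold (𝓡 n) ((⊤ : ℕ∞) + 1) M := by simpa
  have : IsManifold (𝓡 n) (minSmoothness ℝ 2) M := by
    simpa using (inferInstance : IsManifold (𝓡 n) 2 M)
  exact ContMDiffAt.mlieBracket_vectorField (n := ⊤) (m := ⊤) h1 h2 (by simp)

theorem mlieBracket_smul {f : M → ℝ} {X Y : VField n M} {x : M}
    (hf : SmoothFnNear (n := n) f x) (hY : SmoothNear Y x) :
    mlieBracket (𝓡 n) X (fun y => f y • Y y) x
      = dirDeriv f x (X x) • Y x + f x • mlieBracket (𝓡 n) X Y x := by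
  have : IsManifold (𝓡 n) 2 M := inferInstance
  exact mlieBracket_smul_right hf.mdiff hY.mdiff

theorem mlieBracket_smul' {f : M → ℝ} {X Y : VField n M} {x : M}
    (hf : SmoothFnNear (n := n) f x) (hX : SmoothNear X x) :
    mlieBracket (𝓡 n) (fun y => f y • X y) Y x
      = -dirDeriv f x (Y x) • X x + f x • mlieBracket (𝓡 n) X Y x := by
  have : IsManifold (𝓡 n) 2 M := inferInstance
  exact mlieBracket_smul_left hf.mdiff hX.mdiff

theorem mlieBracket_add {X Y Z : VField n M} {x : M} (hY : SmoothNear Y x) (hZ : SmoothNear Z x) :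
    mlieBracket (𝓡 n) X (fun y => Y y + Z y) x
      = mlieBracket (𝓡 n) X Y x + mlieBracket (𝓡 n) X Z x := by
  have : IsManifold (𝓡 n) 2 M := inferInstance
  exact mlieBracket_add_right hY.mdiff hZ.mdiff

/-- The Lie bracket acts on functions as a commutator. -/
theorem dirDeriv_mlieBracket {f : M → ℝ} {X Y : VField n M} {x : M}
    (hf : SmoothFnNear (n := n) f x) (hX : SmoothNear X x) (hY : SmoothNear Y x) :
    dirDeriv f x (mlieBracket (𝓡 n) X Y x)
      = dirDeriv (fun y => dirDeriv f y (Y y)) x (X x)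
        - dirDeriv (fun y => dirDeriv f y (X y)) x (Y x) := by
  have : IsManifold (𝓡 n) (minSmoothness ℝ 3) M := by
    simpa using (inferInstance : IsManifold (𝓡 n) 3 M)
  -- the Jacobi identity for `X`, `Y` and `f Z`
  have key : ∀ Z : VField n M, SmoothNear Z x →
      (dirDeriv f x (mlieBracket (𝓡 n) X Y x)
      - (dirDeriv (fun y => dirDeriv f y (Y y)) x (X x)
        - dirDeriv (fun y => dirDeriv f y (X y)) x (Y x))) • Z x = 0 := by
    intro Z hZ
    have hl : ∀ A : VField n M, SmoothNear A x →
        ContMDiffAt (𝓡 n) ((𝓡 n).prod 𝓘(ℝ, Model n)) (minSmoothness ℝ 2)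
          (fun x => TotalSpace.mk' (Model n) (E := fun x : M => TangentSpace (𝓡 n) x) x (A x)) x :=
      fun A hA => hA.smoothFieldAt.of_le (by simpa using ENat.LEInfty.out)
    have hb : ∀ A : VField n M, SmoothNear A x → ∀ᶠ y in 𝓝 x,
        mlieBracket (𝓡 n) A (fun y => f y • Z y) y
          = dirDeriv f y (A y) • Z y + f y • mlieBracket (𝓡 n) A Z y := by
      intro A hA
      filter_upwards [hf.eventually, hA.eventually, hZ.eventually] with y h1 h2 h3
      exact mlieBracket_smul h1 h3
    have h2 : ∀ A B : VField n M, SmoothNear A x → SmoothNear B x →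
        mlieBracket (𝓡 n) B (mlieBracket (𝓡 n) A (fun y => f y • Z y)) x
          = dirDeriv (fun y => dirDeriv f y (A y)) x (B x) • Z x
            + dirDeriv f x (A x) • mlieBracket (𝓡 n) B Z x
            + (dirDeriv f x (B x) • mlieBracket (𝓡 n) A Z x
              + f x • mlieBracket (𝓡 n) B (mlieBracket (𝓡 n) A Z) x) := by
      intro A B hA hB
      rw [EventuallyEq.mlieBracket_vectorField_eq (EventuallyEq.refl _ B) (hb A hA),
        mlieBracket_add ((smoothFnNear_dirDeriv hf hA |> SmoothNear.smul) hZ)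
          (SmoothNear.smul hf (hA.mlieBracket hZ)),
        mlieBracket_smul (smoothFnNear_dirDeriv hf hA) hZ,
        mlieBracket_smul hf (hA.mlieBracket hZ)]
    have j1 := leibniz_identity_mlieBracket_apply (hl X hX) (hl Y hY) (hl _ (SmoothNear.smul hf hZ))
    have j2 := leibniz_identity_mlieBracket_apply (hl X hX) (hl Y hY) (hl _ hZ)
    -- After the Jacobi identity for Z is used, the terms in [X,Z] and [Y,Z] cancel and only a
    -- multiple of Z x survives.
    rw [h2 Y X hY hX, h2 X Y hX hY, mlieBracket_smul hf hZ, j2] at j1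
    have := sub_eq_zero.mpr j1
    rw [← neg_eq_zero, ← this]
    module
  -- Z x is arbitrary, so a nonzero coefficient would force T_xM = 0; but then both sides are
  -- derivatives along the zero vector.
  by_contra hne
  have hz : ∀ u : TangentSpace (𝓡 n) x, u = 0 := by
    intro u
    have := key (extField u) (smoothNear_extField u)
    rw [extField_self] at this
    exact (smul_eq_zero.mp this).resolve_left (sub_ne_zero.mpr hne)
  apply hne
  rw [hz (mlieBracket (𝓡 n) X Y x), hz (X x), hz (Y x)]
  simp

end Calculus

/-! ### The Levi-Civita connection from the Koszul formula. -/

section LeviCivita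

variable {n : ℕ} {M : Type*} [TopologicalSpace M] [ChartedSpace (Model n) M]
  [IsManifold (𝓡 n) ∞ M]

/-- The vector field `X` is differentiable at `x`. -/
def DiffFieldAt (X : VField n M) (x : M) : Prop :=
  MDifferentiableAt (𝓡 n) ((𝓡 n).prod 𝓘(ℝ, Model n))
    (fun x => TotalSpace.mk' (Model n) (E := fun x : M => TangentSpace (𝓡 n) x) x (X x)) x

theorem SmoothNear.diffFieldAt {X : VField n M} {x : M} (h : SmoothNear X x) : DiffFieldAt X x :=
  h.mdiff

theorem diffFieldAt_extField {x : M} (u : TangentSpace (𝓡 n) x) : DiffFieldAt (extField u) x :=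
  (smoothNear_extField u).mdiff

section Inner

variable (g : Metric n M) {x : M}

theorem inner_add_left (u v w : TangentSpace (𝓡 n) x) :
    g.inner x (u + v) w = g.inner x u w + g.inner x v w := by
  rw [map_add]; rfl

theorem inner_sub_left (u v w : TangentSpace (𝓡 n) x) :
    g.inner x (u - v) w = g.inner x u w - g.inner x v w := by
  rw [map_sub]; rfl

theorem inner_neg_left (u w : TangentSpace (𝓡 n) x) :
    g.inner x (-u) w = -g.inner x u w := by
  rw [map_neg]; rfl

theorem inner_smul_left (c : ℝ) (u w : TangentSpace (𝓡 n) x) :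
    g.inner x (c • u) w = c * g.inner x u w := by
  rw [map_smul]; rfl

theorem inner_zero_left (w : TangentSpace (𝓡 n) x) : g.inner x 0 w = 0 := by
  rw [map_zero]; rfl

theorem inner_add_right (u v w : TangentSpace (𝓡 n) x) :
    g.inner x u (v + w) = g.inner x u v + g.inner x u w := map_add _ _ _

theorem inner_sub_right (u v w : TangentSpace (𝓡 n) x) :
    g.inner x u (v - w) = g.inner x u v - g.inner x u w := map_sub _ _ _

theorem inner_smul_right (c : ℝ) (u w : TangentSpace (𝓡 n) x) :
    g.inner x u (c • w) = c * g.inner x u w := map_smul _ _ _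

theorem inner_zero_right (u : TangentSpace (𝓡 n) x) : g.inner x u 0 = 0 := map_zero _

theorem inner_sum_left {ι : Type*} (s : Finset ι) (u : ι → TangentSpace (𝓡 n) x)
    (w : TangentSpace (𝓡 n) x) : g.inner x (∑ i ∈ s, u i) w = ∑ i ∈ s, g.inner x (u i) w := by
  rw [map_sum]
  exact sum_apply _ _ _

theorem inner_sum_right {ι : Type*} (s : Finset ι) (u : TangentSpace (𝓡 n) x)
    (w : ι → TangentSpace (𝓡 n) x) : g.inner x u (∑ i ∈ s, w i) = ∑ i ∈ s, g.inner x u (w i) :=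
  map_sum _ _ _

theorem eq_of_inner_eq {u v : TangentSpace (𝓡 n) x} (h : ∀ w, g.inner x u w = g.inner x v w) :
    u = v := by
  by_contra hne
  have := g.pos x (u - v) (sub_ne_zero.mpr hne)
  rw [inner_sub_left, h, sub_self] at this
  exact lt_irrefl _ this

theorem inner_onb_sum (u w : TangentSpace (𝓡 n) x) :
    ∑ i, g.inner x (onb g x i) u * g.inner x (onb g x i) w = g.inner x u w := by
  have hr : ∀ i, g.inner x (onb g x i) u = (onb g x).repr u i := by
    intro i
    conv_lhs => rw [← (onb g x).sum_repr u]
    simp only [inner_sum_right, inner_smul_right, onb_spec]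
    simp
  conv_rhs => rw [← (onb g x).sum_repr u, inner_sum_left]
  exact Finset.sum_congr rfl fun i _ => by rw [inner_smul_left, hr]

theorem onb_sum (u : TangentSpace (𝓡 n) x) : ∑ i, g.inner x (onb g x i) u • onb g x i = u := by
  refine eq_of_inner_eq g fun w => ?_
  rw [inner_sum_left, ← inner_onb_sum g u w]
  exact Finset.sum_congr rfl fun i _ => inner_smul_left g _ _ _

/-- Riesz representation in the chosen orthonormal basis. It characterizes `grad` and `nabla` by
their pairings, after which the choice of basis no longer matters. -/
theorem inner_functional_sum (L : TangentSpace (𝓡 n) x →ₗ[ℝ] ℝ) (u : TangentSpace (𝓡 n) x) :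
    g.inner x (∑ i, L (onb g x i) • onb g x i) u = L u := by
  conv_rhs => rw [← onb_sum g u, map_sum]
  rw [inner_sum_left]
  refine Finset.sum_congr rfl fun i _ => ?_
  rw [inner_smul_left, map_smul, smul_eq_mul, mul_comm]

theorem mdifferentiableAt_inner {X Y : VField n M} (hX : DiffFieldAt X x) (hY : DiffFieldAt Y x) :
    MDifferentiableAt (𝓡 n) 𝓘(ℝ, ℝ) (fun y => g.inner y (X y) (Y y)) x := by
  have h1 := (g.contMDiff.contMDiffAt (x := x)).mdifferentiableAt (by simp)
  have := MDifferentiableAt.clm_bundle_apply₂ (F₁ := Model n) (F₂ := Model n) (F₃ := ℝ)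
    (E₃ := fun _ : M => ℝ) h1 hX hY
  simp only [mdifferentiableAt_totalSpace] at this
  exact this.2

theorem SmoothNear.inner {X Y : VField n M} (hX : SmoothNear X x) (hY : SmoothNear Y x) :
    SmoothFnNear (n := n) (fun y => g.inner y (X y) (Y y)) x := by
  filter_upwards [hX, hY] with y h1 h2
  have := ContMDiffAt.clm_bundle_apply₂ (F₁ := Model n) (F₂ := Model n) (F₃ := ℝ)
    (E₃ := fun _ : M => ℝ) (g.contMDiff.contMDiffAt (x := y)) h1 h2
  simp only [contMDiffAt_totalSpace] at this
  exact this.2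

end Inner

/-- Derivatives of the scaling function produced by the product rule cancel those produced by the
brackets. Only the value at x then matters, so the extension used in `nabla` may be replaced by any
other; `koszul_tensorialAt_right` does the same for the third slot. -/
theorem koszul_tensorialAt_left (g : Metric n M) {Y Z : VField n M} {x : M} (hY : DiffFieldAt Y x)
    (hZ : DiffFieldAt Z x) : TensorialAt (𝓡 n) (Model n) (fun X => koszul g X Y Z x) x where
  smul {f X} hf hX := by
    have : IsManifold (𝓡 n) 2 M := inferInstance
    have e1 : (fun y => g.inner y (Z y) ((f • X) y)) = fun y => f y * g.inner y (Z y) (X y) :=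
      funext fun y => inner_smul_right g _ _ _
    have e2 : (fun y => g.inner y ((f • X) y) (Y y)) = fun y => f y * g.inner y (X y) (Y y) :=
      funext fun y => inner_smul_left g _ _ _
    simp only [koszul]
    rw [e1, e2, dirDeriv_mul hf (mdifferentiableAt_inner g hZ hX),
      dirDeriv_mul hf (mdifferentiableAt_inner g hX hY),
      mlieBracket_smul_left hf hX, mlieBracket_smul_left hf hX]
    simp only [Pi.smul_apply', dirDeriv_vsmul, inner_add_left, inner_smul_left, inner_smul_right,
      smul_eq_mul]
    rw [g.symm x (Z x) (X x)]
    simp only [dirDeriv]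
    ring
  add {X X'} hX hX' := by
    have : IsManifold (𝓡 n) 2 M := inferInstance
    have e1 : (fun y => g.inner y (Z y) ((X + X') y))
        = fun y => g.inner y (Z y) (X y) + g.inner y (Z y) (X' y) :=
      funext fun y => inner_add_right g _ _ _
    have e2 : (fun y => g.inner y ((X + X') y) (Y y))
        = fun y => g.inner y (X y) (Y y) + g.inner y (X' y) (Y y) :=
      funext fun y => inner_add_left g _ _ _
    simp only [koszul]
    rw [e1, e2, dirDeriv_add (mdifferentiableAt_inner g hZ hX) (mdifferentiableAt_inner g hZ hX'),
      dirDeriv_add (mdifferentiableAt_inner g hX hY) (mdifferentiableAt_inner g hX' hY),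
      mlieBracket_add_left hX hX', mlieBracket_add_left hX hX']
    simp only [Pi.add_apply, dirDeriv_vadd, inner_add_left, inner_add_right]
    ring

theorem koszul_tensorialAt_right (g : Metric n M) {X Y : VField n M} {x : M} (hX : DiffFieldAt X x)
    (hY : DiffFieldAt Y x) : TensorialAt (𝓡 n) (Model n) (fun Z => koszul g X Y Z x) x where
  smul {f Z} hf hZ := by
    have : IsManifold (𝓡 n) 2 M := inferInstance
    have e1 : (fun y => g.inner y (Y y) ((f • Z) y)) = fun y => f y * g.inner y (Y y) (Z y) :=
      funext fun y => inner_smul_right g _ _ _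
    have e2 : (fun y => g.inner y ((f • Z) y) (X y)) = fun y => f y * g.inner y (Z y) (X y) :=
      funext fun y => inner_smul_left g _ _ _
    simp only [koszul]
    rw [e1, e2, dirDeriv_mul hf (mdifferentiableAt_inner g hY hZ),
      dirDeriv_mul hf (mdifferentiableAt_inner g hZ hX),
      mlieBracket_smul_right hf hZ, mlieBracket_smul_right hf hZ]
    simp only [Pi.smul_apply', dirDeriv_vsmul, inner_add_left, inner_smul_left, inner_smul_right,
      smul_eq_mul]
    rw [g.symm x (Z x) (X x), g.symm x (Z x) (Y x)]
    simp only [dirDeriv]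
    ring
  add {Z Z'} hZ hZ' := by
    have : IsManifold (𝓡 n) 2 M := inferInstance
    have e1 : (fun y => g.inner y (Y y) ((Z + Z') y))
        = fun y => g.inner y (Y y) (Z y) + g.inner y (Y y) (Z' y) :=
      funext fun y => inner_add_right g _ _ _
    have e2 : (fun y => g.inner y ((Z + Z') y) (X y))
        = fun y => g.inner y (Z y) (X y) + g.inner y (Z' y) (X y) :=
      funext fun y => inner_add_left g _ _ _
    simp only [koszul]
    rw [e1, e2, dirDeriv_add (mdifferentiableAt_inner g hY hZ) (mdifferentiableAt_inner g hY hZ'),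
      dirDeriv_add (mdifferentiableAt_inner g hZ hX) (mdifferentiableAt_inner g hZ' hX),
      mlieBracket_add_right hZ hZ', mlieBracket_add_right hZ hZ']
    simp only [Pi.add_apply, dirDeriv_vadd, inner_add_left, inner_add_right]
    ring

/-- The Koszul formula: `nabla` is characterized by its pairings. -/
theorem inner_nabla (g : Metric n M) {X Y Z : VField n M} {x : M} (hX : DiffFieldAt X x)
    (hY : DiffFieldAt Y x) (hZ : DiffFieldAt Z x) :
    g.inner x (nabla g (X x) Y) (Z x) = 1 / 2 * koszul g X Y Z x := by
  have hE := diffFieldAt_extField (X x)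
  have h1 : koszul g X Y Z x = koszul g (extField (X x)) Y Z x :=
    (koszul_tensorialAt_left g hY hZ).pointwise hX hE (extField_self _).symm
  have hR := koszul_tensorialAt_right g hE hY
  have h2 : ∀ u, koszul g (extField (X x)) Y (extField u) x = hR.mkHom _ _ u := fun u => rfl
  have h3 : koszul g (extField (X x)) Y Z x = hR.mkHom _ _ (Z x) := (hR.mkHom_apply hZ).symm
  rw [h1, h3]
  simp only [nabla, h2]
  exact inner_functional_sum g ((1 / 2 : ℝ) • (hR.mkHom _ _).toLinearMap) (Z x)

theorem inner_nabla' (g : Metric n M) {Y : VField n M} {x : M} (u w : TangentSpace (𝓡 n) x)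
    (hY : DiffFieldAt Y x) :
    g.inner x (nabla g u Y) w = 1 / 2 * koszul g (extField u) Y (extField w) x := by
  have := inner_nabla g (diffFieldAt_extField u) hY (diffFieldAt_extField w)
  rwa [extField_self, extField_self] at this

theorem nabla_congr (g : Metric n M) {Y Y' : VField n M} {x : M} (u : TangentSpace (𝓡 n) x)
    (h : ∀ᶠ y in 𝓝 x, Y y = Y' y) : nabla g u Y = nabla g u Y' := by
  have h' : Y =ᶠ[𝓝 x] Y' := h
  have hk : ∀ X Z : VField n M, koszul g X Y Z x = koszul g X Y' Z x := by
    intro X Z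
    simp only [koszul]
    rw [h.self_of_nhds, EventuallyEq.mlieBracket_vectorField_eq (EventuallyEq.refl _ X) h',
      EventuallyEq.mlieBracket_vectorField_eq h' (EventuallyEq.refl _ Z),
      dirDeriv_congr (f := fun y => g.inner y (Y y) (Z y)) (f' := fun y => g.inner y (Y' y) (Z y))
        (h.mono fun y hy => by rw [hy]),
      dirDeriv_congr (f := fun y => g.inner y (X y) (Y y)) (f' := fun y => g.inner y (X y) (Y' y))
        (h.mono fun y hy => by rw [hy])]
  simp only [nabla, hk]

section Vector

variable (g : Metric n M) {x : M} {Y Y' : VField n M}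

theorem nabla_vadd (u v : TangentSpace (𝓡 n) x) (hY : DiffFieldAt Y x) :
    nabla g (u + v) Y = nabla g u Y + nabla g v Y := by
  refine eq_of_inner_eq g fun w => ?_
  rw [inner_add_left, inner_nabla' g _ _ hY, inner_nabla' g _ _ hY, inner_nabla' g _ _ hY]
  have hT := koszul_tensorialAt_left g hY (diffFieldAt_extField w)
  have h2 : ∀ u, koszul g (extField u) Y (extField w) x = hT.mkHom _ _ u := fun u => rfl
  rw [h2, h2, h2, map_add]; ring

theorem nabla_vsmul (c : ℝ) (u : TangentSpace (𝓡 n) x) (hY : DiffFieldAt Y x) :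
    nabla g (c • u) Y = c • nabla g u Y := by
  refine eq_of_inner_eq g fun w => ?_
  rw [inner_smul_left, inner_nabla' g _ _ hY, inner_nabla' g _ _ hY]
  have hT := koszul_tensorialAt_left g hY (diffFieldAt_extField w)
  have h2 : ∀ u, koszul g (extField u) Y (extField w) x = hT.mkHom _ _ u := fun u => rfl
  rw [h2, h2, map_smul, smul_eq_mul]; ring

theorem nabla_add (u : TangentSpace (𝓡 n) x) (hY : DiffFieldAt Y x) (hY' : DiffFieldAt Y' x) :
    nabla g u (fun y => Y y + Y' y) = nabla g u Y + nabla g u Y' := by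
  have : IsManifold (𝓡 n) 2 M := inferInstance
  refine eq_of_inner_eq g fun w => ?_
  have hs : DiffFieldAt (fun y => Y y + Y' y) x := mdifferentiableAt_add_section hY hY'
  have hU := diffFieldAt_extField u
  have hW := diffFieldAt_extField w
  rw [inner_add_left, inner_nabla' g _ _ hY, inner_nabla' g _ _ hY', inner_nabla' g _ _ hs]
  simp only [koszul, inner_add_left, inner_add_right]
  have b1 := mlieBracket_add_right (V := extField u) hY hY'
  have b2 := mlieBracket_add_left (W := extField w) hY hY'
  change mlieBracket (𝓡 n) (extField u) (fun y => Y y + Y' y) x = _ at b1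
  change mlieBracket (𝓡 n) (fun y => Y y + Y' y) (extField w) x = _ at b2
  rw [dirDeriv_add (mdifferentiableAt_inner g hY hW) (mdifferentiableAt_inner g hY' hW),
    dirDeriv_add (mdifferentiableAt_inner g hU hY) (mdifferentiableAt_inner g hU hY'), b1, b2]
  simp only [dirDeriv_vadd, inner_add_left]
  ring

theorem nabla_smul {f : M → ℝ} (u : TangentSpace (𝓡 n) x)
    (hf : MDifferentiableAt (𝓡 n) 𝓘(ℝ, ℝ) f x) (hY : DiffFieldAt Y x) :
    nabla g u (fun y => f y • Y y) = dirDeriv f x u • Y x + f x • nabla g u Y := by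
  have : IsManifold (𝓡 n) 2 M := inferInstance
  refine eq_of_inner_eq g fun w => ?_
  have hs : DiffFieldAt (fun y => f y • Y y) x := hf.smul_section hY
  have hU := diffFieldAt_extField u
  have hW := diffFieldAt_extField w
  rw [inner_add_left, inner_smul_left, inner_smul_left, inner_nabla' g _ _ hY,
    inner_nabla' g _ _ hs]
  simp only [koszul, inner_smul_left, inner_smul_right]
  have b1 := mlieBracket_smul_right (V := extField u) hf hY
  have b2 := mlieBracket_smul_left (W := extField w) hf hY
  change mlieBracket (𝓡 n) (extField u) (fun y => f y • Y y) x = _ at b1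
  change mlieBracket (𝓡 n) (fun y => f y • Y y) (extField w) x = _ at b2
  rw [dirDeriv_mul hf (mdifferentiableAt_inner g hY hW),
    dirDeriv_mul hf (mdifferentiableAt_inner g hU hY), b1, b2]
  simp only [dirDeriv_vsmul, inner_add_left, inner_smul_left, extField_self]
  rw [g.symm x u]
  simp only [dirDeriv]
  ring

theorem nabla_const_smul (c : ℝ) (u : TangentSpace (𝓡 n) x) (hY : DiffFieldAt Y x) :
    nabla g u (fun y => c • Y y) = c • nabla g u Y := by
  rw [nabla_smul g u (f := fun _ => c) mdifferentiableAt_const hY, dirDeriv_const]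
  module

theorem nabla_sub (u : TangentSpace (𝓡 n) x) (hY : DiffFieldAt Y x) (hY' : DiffFieldAt Y' x) :
    nabla g u (fun y => Y y - Y' y) = nabla g u Y - nabla g u Y' := by
  have e : (fun y => Y y - Y' y) = fun y => Y y + (-1 : ℝ) • Y' y := by
    funext y; module
  have h : DiffFieldAt (fun y => (-1 : ℝ) • Y' y) x :=
    (mdifferentiableAt_const (c := (-1 : ℝ))).smul_section hY'
  rw [e, nabla_add g u hY h, nabla_const_smul g _ u hY']
  module

/-- `nabla` is compatible with the metric. -/
theorem dirDeriv_inner (u : TangentSpace (𝓡 n) x) (hY : DiffFieldAt Y x) (hY' : DiffFieldAt Y' x) :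
    dirDeriv (fun y => g.inner y (Y y) (Y' y)) x u
      = g.inner x (nabla g u Y) (Y' x) + g.inner x (Y x) (nabla g u Y') := by
  have hU := diffFieldAt_extField u
  have h1 := inner_nabla g hU hY hY'
  have h2 := inner_nabla g hU hY' hY
  rw [extField_self] at h1 h2
  rw [g.symm x (Y x), h1, h2]
  simp only [koszul]
  rw [mlieBracket_swap_apply (V := Y') (W := Y), inner_neg_left]
  have e : ∀ A B : VField n M, (fun y => g.inner y (A y) (B y)) = fun y => g.inner y (B y) (A y) :=
    fun A B => funext fun y => g.symm y _ _
  rw [e Y' Y, e Y' (extField u), e (extField u) Y, extField_self]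
  ring

/-- `nabla` is torsion free. -/
theorem mlieBracket_eq (hY : DiffFieldAt Y x) (hY' : DiffFieldAt Y' x) :
    mlieBracket (𝓡 n) Y Y' x = nabla g (Y x) Y' - nabla g (Y' x) Y := by
  refine eq_of_inner_eq g fun w => ?_
  have hW := diffFieldAt_extField w
  have h1 := inner_nabla g hY hY' hW
  have h2 := inner_nabla g hY' hY hW
  rw [extField_self] at h1 h2
  rw [inner_sub_left, h1, h2]
  simp only [koszul]
  rw [mlieBracket_swap_apply (V := Y') (W := Y), inner_neg_left]
  have e : ∀ A B : VField n M, (fun y => g.inner y (A y) (B y)) = fun y => g.inner y (B y) (A y) :=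
    fun A B => funext fun y => g.symm y _ _
  rw [e Y' Y, e Y' (extField w), e (extField w) Y, extField_self]
  ring

end Vector

/-- A torsion free operation compatible with the metric satisfies the Koszul formula. -/
theorem nabla_eq_of_forall (g : Metric n M) {x : M} {u : TangentSpace (𝓡 n) x} {Y : VField n M}
    (hY : SmoothNear Y x) (B : TangentSpace (𝓡 n) x → VField n M → TangentSpace (𝓡 n) x)
    (hc : ∀ (v : TangentSpace (𝓡 n) x) (S T : VField n M), SmoothNear S x → SmoothNear T x →
      dirDeriv (fun y => g.inner y (S y) (T y)) x v
        = g.inner x (B v S) (T x) + g.inner x (S x) (B v T))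
    (ht : ∀ S T : VField n M, SmoothNear S x → SmoothNear T x →
      mlieBracket (𝓡 n) S T x = B (S x) T - B (T x) S) :
    nabla g u Y = B u Y := by
  refine eq_of_inner_eq g fun w => ?_
  have hU := smoothNear_extField u
  have hW := smoothNear_extField w
  rw [inner_nabla' g _ _ hY.diffFieldAt]
  simp only [koszul]
  -- This is the uniqueness argument for the Levi-Civita connection: with derivatives and brackets
  -- expressed by B, everything in the Koszul expression cancels except 2 g(B u Y, w).
  rw [hc _ _ _ hY hW, hc _ _ _ hW hU, hc _ _ _ hU hY, ht _ _ hU hY, ht _ _ hU hW, ht _ _ hY hW]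
  simp only [extField_self, inner_sub_left]
  rw [g.symm x w, g.symm x (Y x), g.symm x u]
  ring

/-- A field is smooth as soon as its pairings with all smooth fields are smooth. -/
theorem smoothNear_of_inner (g : Metric n M) {Z : VField n M} {x : M}
    (h : ∀ Y : VField n M, SmoothNear Y x →
      SmoothFnNear (n := n) (fun y => g.inner y (Z y) (Y y)) x) :
    SmoothNear Z x := by
  set t := trivializationAt (Model n) (fun x : M => TangentSpace (𝓡 n) x) x with ht
  let b : Module.Basis (Fin n) ℝ (Model n) := (EuclideanSpace.basisFun (Fin n) ℝ).toBasis
  let E : Fin n → VField n M := fun i => t.localFrame b i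
  have hb : ∀ᶠ y in 𝓝 x, y ∈ t.baseSet :=
    t.open_baseSet.mem_nhds (FiberBundle.mem_baseSet_trivializationAt' x)
  have hE : ∀ i, SmoothNear (E i) x := by
    intro i
    filter_upwards [hb] with y hy
    exact contMDiffAt_localFrame_of_mem ∞ t b i hy
  let G : M → Matrix (Fin n) (Fin n) ℝ := fun y => Matrix.of fun i j => g.inner y (E i y) (E j y)
  have hG : ∀ i j, SmoothFnNear (n := n) (fun y => G y i j) x := fun i j => (hE i).inner g (hE j)
  have hdet : ∀ A : M → Matrix (Fin n) (Fin n) ℝ,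
      (∀ i j, SmoothFnNear (n := n) (fun y => A y i j) x) →
      SmoothFnNear (n := n) (fun y => (A y).det) x := by
    intro A hA
    have hA' : ∀ᶠ y in 𝓝 x, ∀ i j, ContMDiffAt (𝓡 n) 𝓘(ℝ, ℝ) ∞ (fun y => A y i j) y := by
      simp only [Filter.eventually_all]
      exact hA
    filter_upwards [hA'] with y hy
    simp only [Matrix.det_apply']
    refine contMDiffAt_finsetSum fun σ _ => ContMDiffAt.mul contMDiffAt_const ?_
    exact contMDiffAt_finsetProd fun i _ => hy _ _
  -- A kernel vector v of the Gram matrix gives ∑ vⱼ Eⱼ of norm zero, hence v = 0 by positivity and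
  -- independence of the frame.
  have hne : ∀ᶠ y in 𝓝 x, (G y).det ≠ 0 := by
    filter_upwards [hb] with y hy
    refine fun h0 => ?_
    obtain ⟨v, hv, hv0⟩ := Matrix.exists_mulVec_eq_zero_iff.mpr h0
    have h1 : ∑ j, v j • E j y = 0 := by
      by_contra hne
      have h2 := g.pos y _ hne
      rw [inner_sum_left] at h2
      refine h2.ne' (Finset.sum_eq_zero fun i _ => ?_)
      rw [inner_smul_left, inner_sum_right]
      have := congrFun hv0 i
      simp only [Matrix.mulVec, dotProduct, G, Matrix.of_apply, Pi.zero_apply] at this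
      simp only [inner_smul_right]
      rw [← mul_zero (v i), ← this]
      congr 1
      exact Finset.sum_congr rfl fun j _ => mul_comm _ _
    have hli := (t.basisAt b hy).linearIndependent
    apply hv
    funext i
    refine Fintype.linearIndependent_iff.mp hli v ?_ i
    rw [← h1]
    refine Finset.sum_congr rfl fun j _ => ?_
    rw [← t.localFrame_apply_of_mem_baseSet b hy]
  -- By Cramer's rule the inverse Gram matrix is the adjugate divided by the determinant, hence
  -- smooth.
  have hinv : ∀ i j, SmoothFnNear (n := n) (fun y => (G y)⁻¹ i j) x := by
    intro i j
    have h1 : SmoothFnNear (n := n) (fun y => (G y).adjugate i j) x := by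
      simp only [Matrix.adjugate_apply]
      refine hdet _ fun k l => ?_
      simp only [Matrix.updateRow_apply]
      split_ifs
      · exact SmoothFnNear.const _ _
      · exact hG k l
    have h2 : SmoothFnNear (n := n) (fun y => ((G y).det)⁻¹) x :=
      (hdet G hG).comp (hne.mono fun y hy => contDiffAt_inv ℝ hy)
    refine (h2.mul h1).congr (Eventually.of_forall fun y => ?_)
    simp [Matrix.inv_def]
  -- The coefficients of Z in the frame are its pairings with the frame multiplied by the inverse
  -- Gram matrix.
  refine (SmoothNear.sum (s := Finset.univ)
    (X := fun i y => (∑ j, g.inner y (Z y) (E j y) * (G y)⁻¹ j i) • E i y) fun i _ => ?_).congr ?_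
  · refine SmoothNear.smul ?_ (hE i)
    have : ∀ᶠ y in 𝓝 x, ∀ j, ContMDiffAt (𝓡 n) 𝓘(ℝ, ℝ) ∞
        (fun y => g.inner y (Z y) (E j y) * (G y)⁻¹ j i) y := by
      simp only [Filter.eventually_all]
      exact fun j => (h _ (hE j)).mul (hinv j i)
    filter_upwards [this] with y hy
    exact contMDiffAt_finsetSum fun j _ => hy j
  · filter_upwards [hb, hne] with y hy hy'
    have hspan := (t.basisAt b hy).sum_repr (Z y)
    have hE' : ∀ i, t.basisAt b hy i = E i y := fun i =>
      (t.localFrame_apply_of_mem_baseSet b hy).symm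
    simp only [hE'] at hspan
    set c := (t.basisAt b hy).repr (Z y)
    have hc : ∀ j, g.inner y (Z y) (E j y) = ∑ i, c i * G y i j := by
      intro j
      rw [← hspan, inner_sum_left]
      exact Finset.sum_congr rfl fun i _ => inner_smul_left g _ _ _
    rw [← hspan]
    refine Finset.sum_congr rfl fun i _ => ?_
    congr 1
    have h3 : Matrix.vecMul (Matrix.vecMul c (G y)) (G y)⁻¹ = c := by
      rw [Matrix.vecMul_vecMul, Matrix.mul_nonsing_inv _ (isUnit_iff_ne_zero.mpr hy'),
        Matrix.vecMul_one]
    rw [← congrFun h3 i]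
    simp only [Matrix.vecMul, dotProduct]
    refine Finset.sum_congr rfl fun j _ => ?_
    rw [hspan, hc]

/-- Smoothness cannot be read off the pointwise bases in the definition of `nabla`; it is read off
the pairings, which are Koszul expressions in smooth fields. -/
theorem smoothNear_nabla (g : Metric n M) {X Y : VField n M} {x : M} (hX : SmoothNear X x)
    (hY : SmoothNear Y x) : SmoothNear (fun y => nabla g (X y) Y) x := by
  refine smoothNear_of_inner g fun Z hZ => ?_
  have : SmoothFnNear (n := n) (fun y => 1 / 2 * koszul g X Y Z y) x := by
    refine (SmoothFnNear.const _ _).mul ?_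
    unfold koszul
    refine SmoothFnNear.sub (SmoothFnNear.sub (SmoothFnNear.add (SmoothFnNear.sub
      (SmoothFnNear.add ?_ ?_) ?_) ?_) ?_) ?_
    · exact smoothFnNear_dirDeriv (hY.inner g hZ) hX
    · exact smoothFnNear_dirDeriv (hZ.inner g hX) hY
    · exact smoothFnNear_dirDeriv (hX.inner g hY) hZ
    · exact (hX.mlieBracket hY).inner g hZ
    · exact (hX.mlieBracket hZ).inner g hY
    · exact (hY.mlieBracket hZ).inner g hX
  refine this.congr ?_
  filter_upwards [hX.eventually, hY.eventually, hZ.eventually] with y h1 h2 h3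
  exact inner_nabla g h1.diffFieldAt h2.diffFieldAt h3.diffFieldAt

end LeviCivita

/-! ### Gradient and symmetry of the Hessian. -/

section Gradient

variable {n : ℕ} {M : Type*} [TopologicalSpace M] [ChartedSpace (Model n) M]
  [IsManifold (𝓡 n) ∞ M]

theorem inner_grad (g : Metric n M) (f : M → ℝ) (x : M) (u : TangentSpace (𝓡 n) x) :
    g.inner x (grad g f x) u = dirDeriv f x u :=
  inner_functional_sum g (mvfderiv (𝓡 n) f x).toLinearMap u

theorem inner_grad' (g : Metric n M) (f : M → ℝ) (x : M) (u : TangentSpace (𝓡 n) x) :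
    g.inner x u (grad g f x) = dirDeriv f x u := by
  rw [g.symm, inner_grad]

theorem smoothNear_grad (g : Metric n M) {f : M → ℝ} {x : M} (hf : SmoothFnNear (n := n) f x) :
    SmoothNear (grad g f) x := by
  refine smoothNear_of_inner g fun Y hY => ?_
  simp only [inner_grad]
  exact smoothFnNear_dirDeriv hf hY

/-- The Hessian `g(∇_u grad f, v)` is symmetric. -/
theorem inner_nabla_grad_symm (g : Metric n M) {f : M → ℝ} {x : M}
    (hf : SmoothFnNear (n := n) f x) (u v : TangentSpace (𝓡 n) x) :
    g.inner x (nabla g u (grad g f)) v = g.inner x (nabla g v (grad g f)) u := by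
  have hU := smoothNear_extField u
  have hV := smoothNear_extField v
  have hG := (smoothNear_grad g hf).diffFieldAt
  -- The commutator [U,V]f, with the bracket rewritten by torsion-freeness, is the antisymmetrized
  -- Hessian relation: the terms g(grad f, ∇U) and g(grad f, ∇V) drop out.
  have h1 := dirDeriv_mlieBracket hf hU hV
  rw [mlieBracket_eq g hU.diffFieldAt hV.diffFieldAt] at h1
  simp only [← inner_grad g f, extField_self] at h1
  rw [dirDeriv_inner g u hG hV.diffFieldAt, dirDeriv_inner g v hG hU.diffFieldAt,
    inner_sub_right, extField_self, extField_self] at h1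
  linarith

theorem grad_comp (g : Metric n M) {f : M → ℝ} {x : M} (hf : MDifferentiableAt (𝓡 n) 𝓘(ℝ, ℝ) f x)
    {k : ℝ → ℝ} {k' : ℝ} (hk : HasDerivAt k k' (f x)) :
    grad g (fun y => k (f y)) x = k' • grad g f x := by
  refine eq_of_inner_eq g fun w => ?_
  rw [inner_smul_left, inner_grad, inner_grad, dirDeriv_comp hf hk]

end Gradient

/-! ### Traces over an orthonormal basis and finite sums of fields. -/

section Traces

variable {n : ℕ} {M : Type*} [TopologicalSpace M] [ChartedSpace (Model n) M]
  [IsManifold (𝓡 n) ∞ M] (g : Metric n M) {x : M}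

theorem sum_inner_onb_self : ∑ i, g.inner x (onb g x i) (onb g x i) = n := by
  simp [onb_spec]

/-- `u ↦ ∇_u Y` as a linear map. -/
def nablaLin {Y : VField n M} (hY : DiffFieldAt Y x) :
    TangentSpace (𝓡 n) x →ₗ[ℝ] TangentSpace (𝓡 n) x where
  toFun u := nabla g u Y
  map_add' u v := nabla_vadd g u v hY
  map_smul' c u := nabla_vsmul g c u hY

theorem sum_smul_nabla {Y : VField n M} (hY : DiffFieldAt Y x) (u : TangentSpace (𝓡 n) x) :
    ∑ i, g.inner x (onb g x i) u • nabla g (onb g x i) Y = nabla g u Y := by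
  conv_rhs => rw [← onb_sum g u]
  exact ((map_sum (nablaLin g hY) _ _).trans
    (Finset.sum_congr rfl fun i _ => map_smul (nablaLin g hY) _ _)).symm

theorem diffFieldAt_zero (x : M) : DiffFieldAt (fun y => (0 : TangentSpace (𝓡 n) y)) x :=
  (IsSmoothField.smoothNear (X := fun _ => 0)
    (contMDiff_zeroSection ℝ (fun x : M => TangentSpace (𝓡 n) x)) x).mdiff

theorem nabla_zero (u : TangentSpace (𝓡 n) x) :
    nabla g u (fun y => (0 : TangentSpace (𝓡 n) y)) = 0 := by
  simpa using nabla_const_smul g 0 u (diffFieldAt_zero x)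

theorem nabla_sum {ι : Type*} (s : Finset ι) (Y : ι → VField n M) (u : TangentSpace (𝓡 n) x)
    (hY : ∀ i, DiffFieldAt (Y i) x) :
    DiffFieldAt (fun y => ∑ i ∈ s, Y i y) x
      ∧ nabla g u (fun y => ∑ i ∈ s, Y i y) = ∑ i ∈ s, nabla g u (Y i) := by
  classical
  refine ⟨MDifferentiableAt.sum_section fun i _ => hY i, ?_⟩
  induction s using Finset.induction_on with
  | empty => exact nabla_zero g u
  | insert a s ha ih =>
    have hs : DiffFieldAt (fun y => ∑ i ∈ s, Y i y) x :=
      MDifferentiableAt.sum_section fun i _ => hY i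
    simp only [Finset.sum_insert ha]
    rw [nabla_add g u (hY a) hs, ih]

end Traces

/-! ### Connection and curvature of the deformed metric. -/

section Conformal

variable {n : ℕ} {M : Type*} [TopologicalSpace M] [ChartedSpace (Model n) M]
  [IsManifold (𝓡 n) ∞ M]

/-- The metric `h` is the conformal deformation `e^{2φ} (g + W^♭ ⊗ W^♭)` of Berger type of `g`, where
`W` is a unit parallel field along which `φ` is constant. -/
structure IsBergerDeformation (g h : Metric n M) (W : VField n M) (φ : M → ℝ) : Prop where
  smooth_fun : ∀ x, SmoothFnNear (n := n) φ x
  smooth_field : ∀ x, SmoothNear W x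
  unit : ∀ x, g.inner x (W x) (W x) = 1
  parallel : ∀ (x : M) (u : TangentSpace (𝓡 n) x), nabla g u W = 0
  deriv_eq_zero : ∀ x, dirDeriv φ x (W x) = 0
  inner_eq : ∀ (x : M) (u v : TangentSpace (𝓡 n) x), h.inner x u v
    = Real.exp (2 * φ x) * (g.inner x u v + g.inner x u (W x) * g.inner x v (W x))

namespace IsBergerDeformation

variable {g h : Metric n M} {W : VField n M} {φ : M → ℝ}

theorem smooth_grad (H : IsBergerDeformation g h W φ) (x : M) : SmoothNear (grad g φ) x :=
  smoothNear_grad g (H.smooth_fun x)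

theorem inner_nabla_field (H : IsBergerDeformation g h W φ) {x : M} {Y : VField n M}
    (hY : DiffFieldAt Y x) (u : TangentSpace (𝓡 n) x) :
    g.inner x (nabla g u Y) (W x) = dirDeriv (fun y => g.inner y (Y y) (W y)) x u := by
  rw [dirDeriv_inner g u hY (H.smooth_field x).diffFieldAt, H.parallel, inner_zero_right, add_zero]

/-- As W is parallel, this is the derivative of g(grad φ, W) = Wφ, which vanishes identically. -/
theorem inner_nabla_grad_field (H : IsBergerDeformation g h W φ) {x : M}
    (u : TangentSpace (𝓡 n) x) : g.inner x (nabla g u (grad g φ)) (W x) = 0 := by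
  rw [H.inner_nabla_field (H.smooth_grad x).diffFieldAt]
  simp only [inner_grad, H.deriv_eq_zero, dirDeriv_const]

/-- Since W is parallel, the connection of g is also compatible with g + W^♭ ⊗ W^♭; the conformal
factor is the only source of change. -/
theorem dirDeriv_bergerForm (H : IsBergerDeformation g h W φ) {x : M} {S T : VField n M}
    (hS : SmoothNear S x) (hT : SmoothNear T x) (u : TangentSpace (𝓡 n) x) :
    dirDeriv (fun y => g.inner y (S y) (T y) + g.inner y (S y) (W y) * g.inner y (T y) (W y)) x u
      = g.inner x (nabla g u S) (T x) + g.inner x (S x) (nabla g u T)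
        + (g.inner x (nabla g u S) (W x) * g.inner x (T x) (W x)
          + g.inner x (S x) (W x) * g.inner x (nabla g u T) (W x)) := by
  have hW := H.smooth_field x
  rw [dirDeriv_add (hS.inner g hT).mdiff ((hS.inner g hW).mul (hT.inner g hW)).mdiff,
    dirDeriv_mul (hS.inner g hW).mdiff (hT.inner g hW).mdiff,
    dirDeriv_inner g u hS.diffFieldAt hT.diffFieldAt, H.inner_nabla_field hS.diffFieldAt,
    H.inner_nabla_field hT.diffFieldAt]
  ring

/-- The Levi-Civita connection of the deformed metric. -/
theorem nabla_eq (H : IsBergerDeformation g h W φ) {x : M} {Y : VField n M}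
    (hY : SmoothNear Y x) (u : TangentSpace (𝓡 n) x) :
    nabla h u Y = nabla g u Y + dirDeriv φ x u • Y x + dirDeriv φ x (Y x) • u
      - (g.inner x u (Y x) + g.inner x u (W x) * g.inner x (Y x) (W x)) • grad g φ x := by
  -- The candidate is the conformal change formula over g + W^♭ ⊗ W^♭. The g-gradient may be used
  -- because Wφ = 0.
  refine nabla_eq_of_forall h hY (fun u Y => nabla g u Y + dirDeriv φ x u • Y x
    + dirDeriv φ x (Y x) • u
    - (g.inner x u (Y x) + g.inner x u (W x) * g.inner x (Y x) (W x)) • grad g φ x) ?_ ?_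
  · intro v S T hS hT
    have hW := H.smooth_field x
    have hform := (hS.inner g hT).add ((hS.inner g hW).mul (hT.inner g hW))
    have hk : HasDerivAt (fun t => Real.exp (2 * t)) (Real.exp (2 * φ x) * (2 * 1)) (φ x) :=
      ((hasDerivAt_id (φ x)).const_mul 2).exp
    have hexp : SmoothFnNear (n := n) (fun y => Real.exp (2 * φ y)) x :=
      (H.smooth_fun x).comp (k := fun t => Real.exp (2 * t))
        (Eventually.of_forall fun y => by fun_prop)
    simp only [H.inner_eq]
    rw [dirDeriv_mul hexp.mdiff hform.mdiff, H.dirDeriv_bergerForm hS hT,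
      dirDeriv_comp (H.smooth_fun x).mdiff hk]
    simp only [inner_sub_left, inner_add_left, inner_smul_left, inner_sub_right, inner_add_right,
      inner_smul_right, inner_grad, inner_grad', H.deriv_eq_zero]
    rw [g.symm x v (S x)]
    ring
  · intro S T hS hT
    rw [mlieBracket_eq g hS.diffFieldAt hT.diffFieldAt, g.symm x (S x) (T x)]
    module

/-- In `nabla_eq` with Y = grad φ the two multiples of grad φ cancel, as uφ = g(u, grad φ) and
g(grad φ, W) = 0. -/
theorem nabla_grad (H : IsBergerDeformation g h W φ) {x : M} (u : TangentSpace (𝓡 n) x) :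
    nabla h u (grad g φ) = nabla g u (grad g φ) + gradNormSq g φ x • u := by
  rw [H.nabla_eq (H.smooth_grad x)]
  simp only [inner_grad, inner_grad', H.deriv_eq_zero, gradNormSq]
  module

theorem smooth_gradNormSq (H : IsBergerDeformation g h W φ) (x : M) :
    SmoothFnNear (n := n) (gradNormSq g φ) x :=
  (H.smooth_grad x).inner g (H.smooth_grad x)

theorem dirDeriv_gradNormSq (H : IsBergerDeformation g h W φ) {x : M} (u : TangentSpace (𝓡 n) x) :
    dirDeriv (gradNormSq g φ) x u = 2 * g.inner x (nabla g u (grad g φ)) (grad g φ x) := by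
  have hP := (H.smooth_grad x).diffFieldAt
  refine (dirDeriv_inner g u hP hP).trans ?_
  rw [g.symm x (grad g φ x)]
  ring

/-- The second covariant derivative of `grad φ` for the deformed connection. -/
theorem nabla_nabla_grad (H : IsBergerDeformation g h W φ) {x : M} {E : VField n M}
    (hE : SmoothNear E x) :
    nabla h (E x) (fun y => nabla h (E y) (grad g φ)) - nabla h (nabla g (E x) E) (grad g φ)
      = nabla g (E x) (fun y => nabla g (E y) (grad g φ)) - nabla g (nabla g (E x) E) (grad g φ)
        + (3 * g.inner x (E x) (nabla g (grad g φ x) (grad g φ))) • E x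
        + g.inner x (E x) (grad g φ x) • nabla g (E x) (grad g φ)
        - g.inner x (nabla g (E x) (grad g φ)) (E x) • grad g φ x
        + (2 * gradNormSq g φ x) • (g.inner x (E x) (grad g φ x) • E x)
        - (gradNormSq g φ x * (g.inner x (E x) (E x) + g.inner x (E x) (W x) * g.inner x (E x) (W x)))
          • grad g φ x := by
  have hP := H.smooth_grad x
  have hN := H.smooth_gradNormSq x
  have h1 := smoothNear_nabla g hE hP
  have h2 := SmoothNear.smul hN hE
  have e : (fun y => nabla h (E y) (grad g φ))
      = fun y => nabla g (E y) (grad g φ) + gradNormSq g φ y • E y :=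
    funext fun y => H.nabla_grad (E y)
  -- The coefficient 3 in the statement is 2 from differentiating ‖grad φ‖² plus 1 from the term
  -- Y(φ)u of `nabla_eq`. The term ‖grad φ‖² ∇_E E is cancelled by the correction along ∇_E E.
  rw [e, H.nabla_eq (h1.add h2), nabla_add g _ h1.diffFieldAt h2.diffFieldAt,
    nabla_smul g _ hN.mdiff hE.diffFieldAt, H.nabla_grad, H.dirDeriv_gradNormSq]
  have hs : g.inner x (E x) (nabla g (grad g φ x) (grad g φ))
      = g.inner x (nabla g (E x) (grad g φ)) (grad g φ x) := by
    rw [g.symm, inner_nabla_grad_symm g (H.smooth_fun x)]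
  rw [hs]
  simp only [inner_add_left, inner_add_right, inner_smul_left,
    inner_smul_right, H.inner_nabla_grad_field, ← inner_grad g]
  rw [g.symm x (E x) (grad g φ x), g.symm x (E x) (nabla g (E x) (grad g φ)),
    g.symm x (grad g φ x) (nabla g (E x) (grad g φ))]
  module

/-- Input for the curvature: the formula for the inner derivative holds near x, so it can be
differentiated with the connection of g. The outer correction terms keep the deformed derivative
unexpanded. -/
theorem nabla_nabla_eq (H : IsBergerDeformation g h W φ) {x : M} {V Z : VField n M}
    (hV : SmoothNear V x) (hZ : SmoothNear Z x) (u : TangentSpace (𝓡 n) x) :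
    nabla h u (fun y => nabla h (V y) Z)
      = nabla g u (fun y => nabla g (V y) Z)
        + (g.inner x (nabla g u (grad g φ)) (V x) + g.inner x (grad g φ x) (nabla g u V)) • Z x
        + g.inner x (grad g φ x) (V x) • nabla g u Z
        + (g.inner x (nabla g u (grad g φ)) (Z x) + g.inner x (grad g φ x) (nabla g u Z)) • V x
        + g.inner x (grad g φ x) (Z x) • nabla g u V
        - (g.inner x (nabla g u V) (Z x) + g.inner x (V x) (nabla g u Z)
            + (g.inner x (nabla g u V) (W x) * g.inner x (Z x) (W x)
              + g.inner x (V x) (W x) * g.inner x (nabla g u Z) (W x))) • grad g φ x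
        - (g.inner x (V x) (Z x) + g.inner x (V x) (W x) * g.inner x (Z x) (W x))
          • nabla g u (grad g φ)
        + dirDeriv φ x u • nabla h (V x) Z
        + dirDeriv φ x (nabla h (V x) Z) • u
        - (g.inner x u (nabla h (V x) Z) + g.inner x u (W x) * g.inner x (nabla h (V x) Z) (W x))
          • grad g φ x := by
  have hP := H.smooth_grad x
  have hW := H.smooth_field x
  have f1 := hP.inner g hV
  have f2 := hP.inner g hZ
  have f3 := (hV.inner g hZ).add ((hV.inner g hW).mul (hZ.inner g hW))
  have s0 := smoothNear_nabla g hV hZ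
  have s1 := SmoothNear.smul f1 hZ
  have s2 := SmoothNear.smul f2 hV
  have s3 := SmoothNear.smul f3 hP
  rw [H.nabla_eq (smoothNear_nabla h hV hZ)]
  have e : ∀ᶠ y in 𝓝 x, nabla h (V y) Z = nabla g (V y) Z + g.inner y (grad g φ y) (V y) • Z y
      + g.inner y (grad g φ y) (Z y) • V y
      - (g.inner y (V y) (Z y) + g.inner y (V y) (W y) * g.inner y (Z y) (W y)) • grad g φ y := by
    filter_upwards [hZ.eventually] with y hy
    rw [H.nabla_eq hy, inner_grad, inner_grad]
  rw [nabla_congr g u e, nabla_sub g u ((s0.add s1).add s2).diffFieldAt s3.diffFieldAt,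
    nabla_add g u (s0.add s1).diffFieldAt s2.diffFieldAt,
    nabla_add g u s0.diffFieldAt s1.diffFieldAt, nabla_smul g u f1.mdiff hZ.diffFieldAt,
    nabla_smul g u f2.mdiff hV.diffFieldAt, nabla_smul g u f3.mdiff hP.diffFieldAt,
    H.dirDeriv_bergerForm hV hZ, dirDeriv_inner g u hP.diffFieldAt hV.diffFieldAt,
    dirDeriv_inner g u hP.diffFieldAt hZ.diffFieldAt]
  module

/-- The curvature tensor of the deformed metric. -/
theorem curvature_eq (H : IsBergerDeformation g h W φ) {x : M} (u v w : TangentSpace (𝓡 n) x) :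
    curvature h u v w = curvature g u v w
      - (g.inner x (nabla g v (grad g φ)) w - dirDeriv φ x v * dirDeriv φ x w
          + gradNormSq g φ x / 2 * (g.inner x v w + g.inner x v (W x) * g.inner x w (W x))) • u
      + (g.inner x (nabla g u (grad g φ)) w - dirDeriv φ x u * dirDeriv φ x w
          + gradNormSq g φ x / 2 * (g.inner x u w + g.inner x u (W x) * g.inner x w (W x))) • v
      - (g.inner x v w + g.inner x v (W x) * g.inner x w (W x)) •
          (nabla g u (grad g φ) - dirDeriv φ x u • grad g φ x + (gradNormSq g φ x / 2) • u)
      + (g.inner x u w + g.inner x u (W x) * g.inner x w (W x)) •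
          (nabla g v (grad g φ) - dirDeriv φ x v • grad g φ x + (gradNormSq g φ x / 2) • v) := by
  have hU := smoothNear_extField u
  have hV := smoothNear_extField v
  have hZ := smoothNear_extField w
  simp only [curvature]
  rw [H.nabla_nabla_eq hV hZ, H.nabla_nabla_eq hU hZ, H.nabla_eq hZ, H.nabla_eq hZ, H.nabla_eq hZ]
  have hb := mlieBracket_eq g hU.diffFieldAt hV.diffFieldAt
  simp only [extField_self] at hb ⊢
  have hs := inner_nabla_grad_symm g (H.smooth_fun x) u v
  have hN : gradNormSq g φ x = g.inner x (grad g φ x) (grad g φ x) := rfl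
  have hNφ : dirDeriv φ x (grad g φ x) = gradNormSq g φ x := by rw [← inner_grad]; rfl
  -- The bracket need not be known: torsion-freeness trades ∇_u of the extension of v for b plus ∇_v
  -- of the extension of u, and all first-derivative terms of the extensions then cancel.
  generalize mlieBracket (𝓡 n) (extField u) (extField v) x = b at hb ⊢
  have hb' : nabla g u (extField v) = b + nabla g v (extField u) := by rw [hb]; module
  rw [hb']
  simp only [dirDeriv_vadd, dirDeriv_vsub, dirDeriv_vsmul, inner_add_left, inner_add_right,
    inner_sub_left, inner_sub_right, inner_smul_left, inner_smul_right, inner_grad, inner_grad',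
    H.deriv_eq_zero, hNφ]
  rw [hs, g.symm x v u]
  module

end IsBergerDeformation

end Conformal

/-! ### The pull-back connection along the identity, and homogeneity of the curvature. -/

section Identity

variable {n : ℕ} {M : Type*} [TopologicalSpace M] [ChartedSpace (Model n) M]

theorem mfderiv_id_apply {x : M} (u : TangentSpace (𝓡 n) x) :
    mfderiv (𝓡 n) (𝓡 n) (id : M → M) x u = u := by
  rw [mfderiv_id]; rfl

variable [IsManifold (𝓡 n) ∞ M]

/-- Expand s = ∑ cₖ ∂ₖ in the coordinate frame. The Leibniz rule splits ∇_u s into ∑ u(cₖ) ∂ₖ, the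
first term of `pullbackNabla`, and ∑ cₖ(x) ∇_u ∂ₖ, the derivative of s x extended with frozen
components. -/
theorem pullbackNabla_id (h : Metric n M) {x : M} (u : TangentSpace (𝓡 n) x) {s : VField n M}
    (hs : DiffFieldAt s x) : pullbackNabla h (id : M → M) u s = nabla h u s := by
  set t := trivializationAt (Model n) (fun x : M => TangentSpace (𝓡 n) x) x with ht
  have hx : x ∈ t.baseSet := FiberBundle.mem_baseSet_trivializationAt' x
  have hb : ∀ᶠ y in 𝓝 x, y ∈ t.baseSet := t.open_baseSet.mem_nhds hx
  let c : M → Model n := fun y => (t ⟨y, s y⟩).2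
  let b : Fin n → Model n := fun k => EuclideanSpace.basisFun (Fin n) ℝ k
  let v : Fin n → TangentSpace (𝓡 n) x := fun k => t.symm x (b k)
  have hc : MDifferentiableAt (𝓡 n) 𝓘(ℝ, Model n) c x :=
    (mdifferentiableAt_section _ _).mp hs
  have hck : ∀ k, HasMFDerivAt (𝓡 n) 𝓘(ℝ, ℝ) (fun y => c y k) x
      ((EuclideanSpace.proj (𝕜 := ℝ) k : Model n →L[ℝ] ℝ).comp (mfderiv (𝓡 n) 𝓘(ℝ, Model n) c x)) :=
    fun k => (EuclideanSpace.proj (𝕜 := ℝ) k : Model n →L[ℝ] ℝ).hasMFDerivAt.comp x hc.hasMFDerivAt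
  have hdc : ∀ k, dirDeriv (fun y => c y k) x u = mvfderiv (𝓡 n) c x u k := by
    intro k
    simp only [dirDeriv, mvfderiv, (hck k).mfderiv]
    rfl
  have hsum : ∀ w : Model n, w = ∑ k, w k • b k := fun w => by
    exact ((EuclideanSpace.basisFun (Fin n) ℝ).sum_repr w).symm
  -- The extension of a coordinate vector at x is the coordinate field itself.
  have hE : ∀ k, ∀ y, extField (v k) y = t.symm y (b k) := by
    intro k y
    change t.symm y (t ⟨x, t.symm x (b k)⟩).2 = _
    rw [t.mk_symm hx, t.apply_symm_apply' hx]
  have hsymm : ∀ y ∈ t.baseSet, ∀ w : Model n, t.symm y w = ∑ k, w k • extField (v k) y := by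
    intro y hy w
    simp only [hE]
    conv_lhs => rw [hsum w, ← t.symmL_apply (R := ℝ) hy, map_sum]
    refine Finset.sum_congr rfl fun k _ => ?_
    rw [map_smul, t.symmL_apply hy]
  have hv := fun k => diffFieldAt_extField (v k)
  have e1 : ∀ᶠ y in 𝓝 x, s y = ∑ k, c y k • extField (v k) y := by
    filter_upwards [hb] with y hy
    rw [← hsymm y hy]
    exact (t.symm_apply_apply_mk hy (s y)).symm
  have e2 : ∀ᶠ y in 𝓝 x, extField (s x) y = ∑ k, c x k • extField (v k) y := by
    filter_upwards [hb] with y hy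
    rw [← hsymm y hy]
    rfl
  have n1 : nabla h u s = ∑ k, (dirDeriv (fun y => c y k) x u • v k
      + c x k • nabla h u (extField (v k))) := by
    rw [nabla_congr h u e1, (nabla_sum h _ (fun k y => c y k • extField (v k) y) u
      fun k => (hck k).mdifferentiableAt.smul_section (hv k)).2]
    refine Finset.sum_congr rfl fun k _ => ?_
    rw [nabla_smul h u (hck k).mdifferentiableAt (hv k), extField_self]
  have n2 : nabla h u (extField (s x)) = ∑ k, c x k • nabla h u (extField (v k)) := by
    rw [nabla_congr h u e2, (nabla_sum h _ (fun k y => c x k • extField (v k) y) u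
      fun k => mdifferentiableAt_const.smul_section (hv k)).2]
    exact Finset.sum_congr rfl fun k _ => nabla_const_smul h _ u (hv k)
  have n3 : t.symm x (mvfderiv (𝓡 n) c x u) = ∑ k, dirDeriv (fun y => c y k) x u • v k := by
    rw [hsymm x hx]
    refine Finset.sum_congr rfl fun k _ => ?_
    rw [hdc, extField_self]
  rw [n1, Finset.sum_add_distrib, ← n2, ← n3]
  simp only [pullbackNabla, mfderiv_id]
  rfl

theorem tension_id (g h : Metric n M) (x : M) :
    tension g h (id : M → M) x
      = ∑ i, (nabla h (onb g x i) (extField (onb g x i))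
        - nabla g (onb g x i) (extField (onb g x i))) := by
  refine Finset.sum_congr rfl fun i _ => ?_
  have e : (fun y => mfderiv (𝓡 n) (𝓡 n) (id : M → M) y (extField (onb g x i) y))
      = extField (onb g x i) := funext fun y => mfderiv_id_apply _
  have := pullbackNabla_id h (onb g x i) (diffFieldAt_extField (onb g x i))
  exact congrArg₂ (· - ·) ((congrArg (pullbackNabla h (id : M → M) (onb g x i)) e).trans this)
    (mfderiv_id_apply _)

theorem roughLaplacianAlong_id (g h : Metric n M) {s : VField n M} (hs : ∀ x, SmoothNear s x)
    (x : M) :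
    roughLaplacianAlong g h (id : M → M) s x
      = -∑ i, (nabla h (onb g x i) (fun y => nabla h (extField (onb g x i) y) s)
        - nabla h (nabla g (onb g x i) (extField (onb g x i))) s) := by
  refine congrArg Neg.neg (Finset.sum_congr rfl fun i _ => ?_)
  have e : (fun y => pullbackNabla h (id : M → M) (extField (onb g x i) y) s)
      = fun y => nabla h (extField (onb g x i) y) s :=
    funext fun y => pullbackNabla_id h _ (hs y).diffFieldAt
  have h1 := pullbackNabla_id h (onb g x i)
    (smoothNear_nabla h (smoothNear_extField (onb g x i)) (hs x)).diffFieldAt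
  exact congrArg₂ (· - ·) ((congrArg (pullbackNabla h (id : M → M) (onb g x i)) e).trans h1)
    (pullbackNabla_id h _ (hs x).diffFieldAt)

theorem extField_smul {x : M} (c : ℝ) (u : TangentSpace (𝓡 n) x) {y : M}
    (hy : y ∈ (trivializationAt (Model n) (fun x : M => TangentSpace (𝓡 n) x) x).baseSet) :
    extField (c • u) y = c • extField u y := by
  set t := trivializationAt (Model n) (fun x : M => TangentSpace (𝓡 n) x) x with ht
  have hx : x ∈ t.baseSet := FiberBundle.mem_baseSet_trivializationAt' x
  have h1 : (t ⟨x, c • u⟩).2 = c • (t ⟨x, u⟩).2 := (t.linear ℝ hx).map_smul c u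
  change t.symm y (t ⟨x, c • u⟩).2 = c • t.symm y (t ⟨x, u⟩).2
  rw [h1, ← t.symmL_apply (R := ℝ) hy, ← t.symmL_apply (R := ℝ) hy, map_smul]

/-- `curvature` is defined through extensions, so homogeneity is checked near x, where extending
commutes with scaling. It serves to pull out the factor 1 - n of the tension field, and 1/(2α)
through `ricci_smul`. -/
theorem curvature_smul (g : Metric n M) {x : M} (c : ℝ) (u v w : TangentSpace (𝓡 n) x) :
    curvature g (c • u) v w = c • curvature g u v w := by
  have hU := smoothNear_extField u
  have hV := smoothNear_extField v
  have hZ := smoothNear_extField w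
  have hb : ∀ᶠ y in 𝓝 x,
      y ∈ (trivializationAt (Model n) (fun x : M => TangentSpace (𝓡 n) x) x).baseSet :=
    (trivializationAt (Model n) (fun x : M => TangentSpace (𝓡 n) x) x).open_baseSet.mem_nhds
      (FiberBundle.mem_baseSet_trivializationAt' x)
  have e1 : ∀ᶠ y in 𝓝 x, extField (c • u) y = c • extField u y :=
    hb.mono fun y hy => extField_smul c u hy
  have e2 : ∀ᶠ y in 𝓝 x, nabla g (extField (c • u) y) (extField w)
      = c • nabla g (extField u y) (extField w) := by
    filter_upwards [e1, hZ.eventually] with y hy hz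
    rw [hy, nabla_vsmul g c _ hz.diffFieldAt]
  have e3 : mlieBracket (𝓡 n) (extField (c • u)) (extField v) x
      = c • mlieBracket (𝓡 n) (extField u) (extField v) x := by
    rw [EventuallyEq.mlieBracket_vectorField_eq (V := fun y => c • extField u y) e1
      (EventuallyEq.refl _ (extField v)),
      mlieBracket_smul' (f := fun _ => c) (SmoothFnNear.const c x) hU,
      dirDeriv_const]
    module
  simp only [curvature]
  rw [e3, nabla_congr g v e2, nabla_const_smul g c v (smoothNear_nabla g hU hZ).diffFieldAt,
    nabla_vsmul g c _ hZ.diffFieldAt,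
    nabla_vsmul g c _ (smoothNear_nabla g hV hZ).diffFieldAt]
  module

theorem ricci_smul (g : Metric n M) {x : M} (c : ℝ) (u : TangentSpace (𝓡 n) x) :
    ricci g (c • u) = c • ricci g u := by
  simp only [ricci, curvature_smul, Finset.smul_sum]

end Identity

/-! ### Tension and bitension of the identity in terms of φ. -/

namespace IsBergerDeformation

variable {n : ℕ} {M : Type*} [TopologicalSpace M] [ChartedSpace (Model n) M]
  [IsManifold (𝓡 n) ∞ M] {g h : Metric n M} {W : VField n M} {φ : M → ℝ}

/-- The two symmetric terms of `nabla_eq` contribute 2 grad φ, and the g-trace of g + W^♭ ⊗ W^♭ is n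
+ 1. -/
theorem tension_eq (H : IsBergerDeformation g h W φ) :
    tension g h (id : M → M) = fun x => (1 - (n : ℝ)) • grad g φ x := by
  funext x
  rw [tension_id]
  have e : ∀ i, nabla h (onb g x i) (extField (onb g x i))
        - nabla g (onb g x i) (extField (onb g x i))
      = (2 : ℝ) • (g.inner x (onb g x i) (grad g φ x) • onb g x i)
        - (g.inner x (onb g x i) (onb g x i)
          + g.inner x (onb g x i) (W x) * g.inner x (onb g x i) (W x)) • grad g φ x := by
    intro i
    rw [H.nabla_eq (smoothNear_extField _), inner_grad', extField_self]
    module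
  simp only [e, Finset.sum_sub_distrib, ← Finset.smul_sum, ← Finset.sum_smul,
    Finset.sum_add_distrib, inner_onb_sum, onb_sum, sum_inner_onb_self, H.unit]
  module

/-- Trace of `nabla_nabla_grad`: 4 = 3 + 1 collects the two terms tracing to ∇_{grad φ} grad φ, and
1 - n = 2 - (n + 1). -/
theorem sum_nabla_nabla_grad (H : IsBergerDeformation g h W φ) (x : M) :
    ∑ i, (nabla h (onb g x i) (fun y => nabla h (extField (onb g x i) y) (grad g φ))
        - nabla h (nabla g (onb g x i) (extField (onb g x i))) (grad g φ))
      = -roughLaplacian g (grad g φ) x + (4 : ℝ) • nabla g (grad g φ x) (grad g φ)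
        - laplacian g φ x • grad g φ x + ((1 - n) * gradNormSq g φ x) • grad g φ x := by
  have e := fun i => H.nabla_nabla_grad (smoothNear_extField (onb g x i))
  simp only [extField_self] at e
  simp only [e, Finset.sum_sub_distrib, Finset.sum_add_distrib, ← Finset.smul_sum,
    ← Finset.sum_smul, mul_smul, inner_onb_sum, onb_sum, sum_inner_onb_self,
    H.unit, sum_smul_nabla g (H.smooth_grad x).diffFieldAt, roughLaplacian, laplacian]
  module

/-- With grad φ in the first slot all terms of `curvature_eq` in ‖grad φ‖² and (eᵢφ)² cancel. The
Hessian terms give 2 - (n + 1) times ∇_{grad φ} grad φ. -/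
theorem sum_curvature_grad (H : IsBergerDeformation g h W φ) (x : M) :
    ∑ i, curvature h (grad g φ x) (onb g x i) (onb g x i)
      = ricci g (grad g φ x) - laplacian g φ x • grad g φ x
        + (1 - (n : ℝ)) • nabla g (grad g φ x) (grad g φ) := by
  have e : ∀ i, curvature h (grad g φ x) (onb g x i) (onb g x i)
      = curvature g (grad g φ x) (onb g x i) (onb g x i)
        - g.inner x (nabla g (onb g x i) (grad g φ)) (onb g x i) • grad g φ x
        + g.inner x (onb g x i) (nabla g (grad g φ x) (grad g φ)) • onb g x i
        + g.inner x (onb g x i) (grad g φ x) • nabla g (onb g x i) (grad g φ)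
        - g.inner x (onb g x i) (onb g x i) • nabla g (grad g φ x) (grad g φ)
        - (g.inner x (onb g x i) (W x) * g.inner x (onb g x i) (W x))
          • nabla g (grad g φ x) (grad g φ) := by
    intro i
    rw [H.curvature_eq]
    simp only [← inner_grad g φ, gradNormSq]
    rw [g.symm x (grad g φ x) (onb g x i), g.symm x (nabla g (grad g φ x) (grad g φ)) (onb g x i)]
    have hz : g.inner x (grad g φ x) (W x) = 0 := by rw [inner_grad, H.deriv_eq_zero]
    rw [hz]
    module
  simp only [e, Finset.sum_sub_distrib, Finset.sum_add_distrib,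
    ← Finset.sum_smul, inner_onb_sum, onb_sum, sum_inner_onb_self,
    H.unit, sum_smul_nabla g (H.smooth_grad x).diffFieldAt, ricci, laplacian]
  module

/-- The bitension field of the identity map, in terms of `φ`. -/
theorem bitension_eq (H : IsBergerDeformation g h W φ) (x : M) :
    bitension g h (id : M → M) x = (1 - (n : ℝ)) •
      (roughLaplacian g (grad g φ) x - ricci g (grad g φ x)
        + ((n : ℝ) - 5) • nabla g (grad g φ x) (grad g φ)
        + (2 * laplacian g φ x + ((n : ℝ) - 1) * gradNormSq g φ x) • grad g φ x) := by
  have hP := H.smooth_grad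
  have e1 : roughLaplacianAlong g h (id : M → M) (tension g h (id : M → M)) x
      = -((1 - (n : ℝ)) • ∑ i,
        (nabla h (onb g x i) (fun y => nabla h (extField (onb g x i) y) (grad g φ))
          - nabla h (nabla g (onb g x i) (extField (onb g x i))) (grad g φ))) := by
    rw [H.tension_eq]
    rw [roughLaplacianAlong_id g h (fun y => (hP y).const_smul (1 - (n : ℝ))), Finset.smul_sum]
    refine congrArg Neg.neg (Finset.sum_congr rfl fun i _ => ?_)
    have e : (fun y => nabla h (extField (onb g x i) y) fun y => (1 - (n : ℝ)) • grad g φ y)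
        = fun y => (1 - (n : ℝ)) • nabla h (extField (onb g x i) y) (grad g φ) :=
      funext fun y => nabla_const_smul h _ _ (hP y).diffFieldAt
    rw [e, nabla_const_smul h _ _
      (smoothNear_nabla h (smoothNear_extField (onb g x i)) (hP x)).diffFieldAt,
      nabla_const_smul h _ _ (hP x).diffFieldAt, smul_sub]
  have e2 : ∑ i, curvature h (tension g h (id : M → M) x)
        (mfderiv (𝓡 n) (𝓡 n) (id : M → M) x (onb g x i))
        (mfderiv (𝓡 n) (𝓡 n) (id : M → M) x (onb g x i))
      = (1 - (n : ℝ)) • ∑ i, curvature h (grad g φ x) (onb g x i) (onb g x i) := by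
    rw [H.tension_eq, Finset.smul_sum]
    refine Finset.sum_congr rfl fun i _ => ?_
    rw [mfderiv_id_apply]
    exact curvature_smul h _ _ _ _
  have e3 : bitension g h (id : M → M) x = -((1 - (n : ℝ)) • ∑ i,
        (nabla h (onb g x i) (fun y => nabla h (extField (onb g x i) y) (grad g φ))
          - nabla h (nabla g (onb g x i) (extField (onb g x i))) (grad g φ)))
      - (1 - (n : ℝ)) • ∑ i, curvature h (grad g φ x) (onb g x i) (onb g x i) :=
    congrArg₂ (· - ·) e1 e2
  rw [e3, H.sum_nabla_nabla_grad, H.sum_curvature_grad]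
  module

end IsBergerDeformation

/-! ### Laplacians of products, for the passage from φ to α. -/

section Laplacians

variable {n : ℕ} {M : Type*} [TopologicalSpace M] [ChartedSpace (Model n) M]
  [IsManifold (𝓡 n) ∞ M] (g : Metric n M) {x : M}

/-- `Δ^I (f Z) = f Δ^I Z - 2 ∇_{grad f} Z - Δ(f) Z`. -/
theorem roughLaplacian_smul {f : M → ℝ} {Z : VField n M} (hf : SmoothFnNear (n := n) f x)
    (hZ : SmoothNear Z x) :
    roughLaplacian g (fun y => f y • Z y) x
      = f x • roughLaplacian g Z x - (2 : ℝ) • nabla g (grad g f x) Z - laplacian g f x • Z x := by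
  have hG := smoothNear_grad g hf
  have e : ∀ i, nabla g (onb g x i) (fun y => nabla g (extField (onb g x i) y) fun y => f y • Z y)
      - nabla g (nabla g (onb g x i) (extField (onb g x i))) (fun y => f y • Z y)
      = f x • (nabla g (onb g x i) (fun y => nabla g (extField (onb g x i) y) Z)
        - nabla g (nabla g (onb g x i) (extField (onb g x i))) Z)
        + (2 : ℝ) • (g.inner x (onb g x i) (grad g f x) • nabla g (onb g x i) Z)
        + g.inner x (nabla g (onb g x i) (grad g f)) (onb g x i) • Z x := by
    intro i
    have hE := smoothNear_extField (onb g x i)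
    have hfE := hG.inner g hE
    have hN := smoothNear_nabla g hE hZ
    have h1 : ∀ᶠ y in 𝓝 x, nabla g (extField (onb g x i) y) (fun y => f y • Z y)
        = g.inner y (grad g f y) (extField (onb g x i) y) • Z y
          + f y • nabla g (extField (onb g x i) y) Z := by
      filter_upwards [hf.eventually, hZ.eventually] with y hy hy'
      rw [nabla_smul g _ hy.mdiff hy'.diffFieldAt, inner_grad]
    rw [nabla_congr g _ h1,
      nabla_add g _ (SmoothNear.smul hfE hZ).diffFieldAt (SmoothNear.smul hf hN).diffFieldAt,
      nabla_smul g _ hfE.mdiff hZ.diffFieldAt, nabla_smul g _ hf.mdiff hN.diffFieldAt,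
      nabla_smul g _ hf.mdiff hZ.diffFieldAt, dirDeriv_inner g _ hG.diffFieldAt hE.diffFieldAt]
    simp only [extField_self, inner_grad, inner_grad']
    module
  simp only [roughLaplacian, e, Finset.sum_add_distrib, ← Finset.smul_sum, ← Finset.sum_smul,
    sum_smul_nabla g hZ.diffFieldAt, laplacian]
  module

/-- The divergence of c grad α. It is used for (log α)/2 with c = 1/(2α), and for 1/(2α) with c =
-1/(2α²). -/
theorem laplacian_of_grad_eq {f c α : M → ℝ} (hc : SmoothFnNear (n := n) c x)
    (hα : SmoothFnNear (n := n) α x) (h : ∀ᶠ y in 𝓝 x, grad g f y = c y • grad g α y) :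
    laplacian g f x = g.inner x (grad g c x) (grad g α x) + c x * laplacian g α x := by
  have hG := smoothNear_grad g hα
  have e : ∀ i, g.inner x (nabla g (onb g x i) (grad g f)) (onb g x i)
      = g.inner x (onb g x i) (grad g c x) * g.inner x (onb g x i) (grad g α x)
        + c x * g.inner x (nabla g (onb g x i) (grad g α)) (onb g x i) := by
    intro i
    rw [nabla_congr g _ h, nabla_smul g _ hc.mdiff hG.diffFieldAt, inner_add_left, inner_smul_left,
      inner_smul_left, inner_grad', g.symm x (grad g α x)]
  simp only [laplacian, e, Finset.sum_add_distrib, inner_onb_sum, ← Finset.mul_sum]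

end Laplacians

/-! ### Functions with zero derivative. -/

section Constant

variable {n : ℕ} {M : Type*} [TopologicalSpace M] [ChartedSpace (Model n) M]
  [IsManifold (𝓡 n) ∞ M]

/-- Read in the chart at x, the function has zero derivative on a ball, which is connected, so it is
constant there. -/
theorem isLocallyConstant_of_dirDeriv_eq_zero {f : M → ℝ} (hf : ContMDiff (𝓡 n) 𝓘(ℝ, ℝ) ∞ f)
    (h : ∀ (x : M) (u : TangentSpace (𝓡 n) x), dirDeriv f x u = 0) : IsLocallyConstant f := by
  refine (IsLocallyConstant.iff_eventually_eq f).mpr fun x => ?_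
  set e := extChartAt (𝓡 n) x with he
  have htgt : e.target ∈ 𝓝 (e x) :=
    (isOpen_extChartAt_target x).mem_nhds (mem_extChartAt_target x)
  obtain ⟨r, hr, hball⟩ := Metric.mem_nhds_iff.mp htgt
  have hmf : ∀ y, mfderiv (𝓡 n) 𝓘(ℝ, ℝ) f y = 0 := fun y => by
    ext u
    exact h y u
  have hder : ∀ z ∈ Metric.ball (e x) r, HasFDerivAt (f ∘ e.symm) (0 : Model n →L[ℝ] ℝ) z := by
    intro z hz
    have h1 : MDifferentiableAt 𝓘(ℝ, Model n) (𝓡 n) e.symm z :=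
      ((contMDiffOn_extChartAt_symm (n := ∞) x).contMDiffAt
        ((isOpen_extChartAt_target x).mem_nhds (hball hz))).mdifferentiableAt (by simp)
    have h2 : MDifferentiableAt (𝓡 n) 𝓘(ℝ, ℝ) f (e.symm z) :=
      (hf (e.symm z)).mdifferentiableAt (by simp)
    have h3 := h2.hasMFDerivAt.comp z h1.hasMFDerivAt
    rw [hmf] at h3
    have h4 := h3.hasFDerivAt
    convert! h4 using 1
  have hconst : ∀ z ∈ Metric.ball (e x) r, (f ∘ e.symm) z = (f ∘ e.symm) (e x) := by
    intro z hz
    refine Metric.isOpen_ball.is_const_of_fderiv_eq_zero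
      (convex_ball (e x) r).isPreconnected
      (fun w hw => (hder w hw).differentiableAt.differentiableWithinAt)
      (fun w hw => (hder w hw).fderiv) hz (Metric.mem_ball_self hr)
  have hnear : ∀ᶠ y in 𝓝 x, e y ∈ Metric.ball (e x) r :=
    (continuousAt_extChartAt x).eventually (Metric.ball_mem_nhds _ hr)
  filter_upwards [hnear, extChartAt_source_mem_nhds (I := 𝓡 n) x] with y hy hy'
  have := hconst _ hy
  simpa only [Function.comp_apply, e.left_inv hy', e.left_inv (mem_extChartAt_source x)] using this

end Constant

/-! ### The Berger metric as a deformation with φ = (log α)/2 and W = FV. -/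

section Berger

variable {n : ℕ} {M : Type*} [TopologicalSpace M] [ChartedSpace (Model n) M]
  [IsManifold (𝓡 n) ∞ M] {g h : Metric n M} {F : Tensor11 n M} {V : VField n M} {α : M → ℝ}

theorem grad_half_log (g : Metric n M) (hα : ContMDiff (𝓡 n) 𝓘(ℝ, ℝ) ∞ α) (hpos : ∀ x, 0 < α x) :
    grad g (fun y => Real.log (α y) / 2) = fun y => (1 / (2 * α y)) • grad g α y := by
  funext y
  have hk : HasDerivAt (fun t => Real.log t / 2) (1 / (2 * α y)) (α y) := by
    convert! (Real.hasDerivAt_log (hpos y).ne').div_const 2 using 1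
    have := (hpos y).ne'
    field_simp
  exact grad_comp g (smoothFnNear_of_contMDiff hα y).mdiff (k := fun t => Real.log t / 2) hk

/-- Here the structure of F is converted into properties of FV: g(FV,FV) = g(V,F²V) = 1 and ∇(FV) =
F(∇V) = 0. The choice of φ makes e^{2φ} = α. -/
theorem isBergerDeformation_bergerMetric (hF : IsParaKahlerNorden g F) (hV : IsSmoothField V)
    (hVpar : IsUnitParallel g V) (hα : ContMDiff (𝓡 n) 𝓘(ℝ, ℝ) ∞ α) (hpos : ∀ x, 0 < α x)
    (hFVα : ∀ x, dirDeriv α x (applyField F V x) = 0) :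
    IsBergerDeformation g (bergerMetric g F V α hF.smooth hV hα hpos) (applyField F V)
      (fun y => Real.log (α y) / 2) where
  smooth_fun x := (smoothFnNear_of_contMDiff hα x).comp (k := fun t => Real.log t / 2)
    (Eventually.of_forall fun y => (Real.contDiffAt_log.mpr (hpos y).ne').div_const 2)
  smooth_field x :=
    IsSmoothField.smoothNear (X := applyField F V) (hF.smooth.clm_bundle_apply hV) x
  unit x := by
    rw [applyField, hF.pure, hF.sq, hVpar.unit]
  parallel x u := by
    have h1 := hF.parallel V x u (hV.smoothNear x).mdiff
    rw [hVpar.parallel, map_zero] at h1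
    exact h1
  deriv_eq_zero x := by
    rw [← inner_grad g, grad_half_log g hα hpos, inner_smul_left, inner_grad, hFVα, mul_zero]
  inner_eq x u v := by
    have h2 : Real.exp (2 * (Real.log (α x) / 2)) = α x := by
      rw [mul_div_cancel₀ _ two_ne_zero, Real.exp_log (hpos x)]
    rw [h2]
    exact bergerForm_apply g (applyField F V) α x u v

end Berger

/-! ### From φ to α, and harmonicity. -/

section Main

variable {m : ℕ} {M : Type*} [TopologicalSpace M] [ChartedSpace (Model (2 * m)) M]
  [IsManifold (𝓡 (2 * m)) ∞ M] {g h : Metric (2 * m) M} {F : Tensor11 (2 * m) M}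
  {V : VField (2 * m) M} {α : M → ℝ}

theorem bitension_eq_bitensionBracket (hα : ContMDiff (𝓡 (2 * m)) 𝓘(ℝ, ℝ) ∞ α)
    (hpos : ∀ x, 0 < α x)
    (H : IsBergerDeformation g h (applyField F V) (fun y => Real.log (α y) / 2)) (x : M) :
    bitension g h (id : M → M) x
      = ((1 - 2 * (m : ℝ)) / (2 * α x)) • bitensionBracket g F V α x := by
  have hαs : ∀ y, SmoothFnNear (n := 2 * m) α y := smoothFnNear_of_contMDiff hα
  have hA : ∀ y, SmoothNear (grad g α) y := fun y => smoothNear_grad g (hαs y)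
  have hgrad := grad_half_log g hα hpos
  have hder : ∀ (y : M) (u : TangentSpace (𝓡 (2 * m)) y),
      dirDeriv α y u = 2 * α y * dirDeriv (fun y => Real.log (α y) / 2) y u := by
    intro y u
    rw [← inner_grad g, ← inner_grad g, hgrad, inner_smul_left]
    have := (hpos y).ne'
    field_simp
  -- `∇_{FV} grad α = 0`
  have hzero : ∀ y, nabla g (applyField F V y) (grad g α) = 0 := by
    intro y
    refine eq_of_inner_eq g fun w => ?_
    -- Symmetry of the Hessian moves FV to the second slot, where, being parallel, it can be taken
    -- inside the derivative.
    rw [inner_nabla_grad_symm g (hαs y), H.inner_nabla_field (hA y).diffFieldAt, inner_zero_left]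
    have : (fun y => g.inner y (grad g α y) (applyField F V y)) = fun _ => 0 := by
      funext z
      rw [inner_grad, hder, H.deriv_eq_zero, mul_zero]
    rw [this, dirDeriv_const]
  have hlast : nabla g (applyField F V x) (fun y => nabla g (applyField F V y) (grad g α)) = 0 := by
    rw [funext hzero, nabla_zero]
  -- the functions `1 / (2α)` and `-1 / (2α²)`
  have hf : SmoothFnNear (n := 2 * m) (fun y => 1 / (2 * α y)) x :=
    (hαs x).comp (k := fun t => 1 / (2 * t)) (Eventually.of_forall fun y =>
      contDiffAt_const.div (contDiffAt_const.mul contDiffAt_id)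
        (mul_ne_zero two_ne_zero (hpos y).ne'))
  have hc : SmoothFnNear (n := 2 * m) (fun y => -1 / (2 * α y ^ 2)) x :=
    (hαs x).comp (k := fun t => -1 / (2 * t ^ 2)) (Eventually.of_forall fun y =>
      contDiffAt_const.div (contDiffAt_const.mul (contDiffAt_id.pow 2))
        (mul_ne_zero two_ne_zero (pow_ne_zero 2 (hpos y).ne')))
  have hgf : ∀ y, grad g (fun y => 1 / (2 * α y)) y = (-1 / (2 * α y ^ 2)) • grad g α y := by
    intro y
    have h0 := (hpos y).ne'
    refine grad_comp g (hαs y).mdiff (k := fun t => 1 / (2 * t)) ?_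
    convert! (((hasDerivAt_id (α y)).const_mul 2).inv (mul_ne_zero two_ne_zero h0)) using 1
    · funext t; simp
    · simp only [id]; field_simp
  have hgc : grad g (fun y => -1 / (2 * α y ^ 2)) x = (1 / α x ^ 3) • grad g α x := by
    have h0 := (hpos x).ne'
    refine grad_comp g (hαs x).mdiff (k := fun t => -1 / (2 * t ^ 2)) ?_
    convert! (((hasDerivAt_pow 2 (α x)).const_mul (2 : ℝ)).inv
      (mul_ne_zero two_ne_zero (pow_ne_zero 2 h0))).neg using 1
    · funext t; simp [div_eq_mul_inv]
    · field_simp; ring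
  have hN : g.inner x (grad g α x) (grad g α x) = gradNormSq g α x := rfl
  have hL1 := laplacian_of_grad_eq g hf (hαs x) (Eventually.of_forall fun y => congrFun hgrad y)
  have hL2 := laplacian_of_grad_eq g hc (hαs x) (Eventually.of_forall hgf)
  rw [hgf, inner_smul_left, hN] at hL1
  rw [hgc, inner_smul_left, hN] at hL2
  have hR := roughLaplacian_smul g hf (hA x)
  rw [hL2, hgf, nabla_vsmul g _ _ (hA x).diffFieldAt] at hR
  have hNφ : gradNormSq g (fun y => Real.log (α y) / 2) x
      = (1 / (2 * α x)) ^ 2 * gradNormSq g α x := by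
    rw [gradNormSq, hgrad, inner_smul_left, inner_smul_right, hN]
    ring
  rw [H.bitension_eq, hL1, hNφ, hgrad, hR, ricci_smul, nabla_vsmul g _ _
    (SmoothNear.smul hf (hA x)).diffFieldAt, nabla_smul g _ hf.mdiff (hA x).diffFieldAt,
    ← inner_grad g (fun y => 1 / (2 * α y)), hgf, inner_smul_left, hN]
  simp only [bitensionBracket]
  rw [hlast]
  have h0 := (hpos x).ne'
  push_cast
  -- Coefficients are compared up to the common factor 1 - 2m. For ∇_{grad α} grad α, the Leibniz
  -- rule of `roughLaplacian_smul` gives 1/α² and `bitension_eq` gives (2m-5)/(4α²), in total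
  -- (2m-1)/(4α²).
  match_scalars <;> field_simp <;> ring

/-- The tension field is (1-2m)/(2α) grad α with a nowhere zero factor, so harmonicity says that α
is locally constant. -/
theorem isHarmonic_iff [ConnectedSpace M] (hα : ContMDiff (𝓡 (2 * m)) 𝓘(ℝ, ℝ) ∞ α)
    (hpos : ∀ x, 0 < α x)
    (H : IsBergerDeformation g h (applyField F V) (fun y => Real.log (α y) / 2)) :
    IsHarmonic g h (id : M → M) ↔ ∃ c : ℝ, ∀ x : M, α x = c := by
  -- Parity: 2m is never 1, so the case m = 0 needs no separate treatment.
  have hm : (1 - ((2 * m : ℕ) : ℝ)) ≠ 0 := by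
    rw [sub_ne_zero]
    norm_cast
    omega
  have hτ : ∀ x, tension g h (id : M → M) x = 0 ↔ grad g α x = 0 := by
    intro x
    have h1 : tension g h (id : M → M) x = _ := congrFun H.tension_eq x
    rw [h1, grad_half_log g hα hpos]
    refine (smul_eq_zero_iff_right hm).trans (smul_eq_zero_iff_right ?_)
    exact one_div_ne_zero (mul_ne_zero two_ne_zero (hpos x).ne')
  constructor
  · rintro ⟨-, h0⟩
    have hloc : IsLocallyConstant α := isLocallyConstant_of_dirDeriv_eq_zero hα fun x u => by
      rw [← inner_grad g, (hτ x).mp (h0 x), inner_zero_left]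
    -- A connected space is nonempty, which supplies the constant value.
    obtain ⟨x₀⟩ := (inferInstance : Nonempty M)
    exact ⟨α x₀, fun x => hloc.apply_eq_of_preconnectedSpace x x₀⟩
  · rintro ⟨c, hc⟩
    refine ⟨contMDiff_id, fun x => (hτ x).mpr (eq_of_inner_eq g fun w => ?_)⟩
    rw [inner_grad, inner_zero_left, funext hc, dirDeriv_const]

end Main

end BergerBiharmonic

end

/-- The bitension field of the identity map `I : (M, F, g) → (M, g^α)`, and the resulting
characterizations of its biharmonicity and of its proper biharmonicity. -/
theorem theorem14 {m : ℕ} {M : Type*} [TopologicalSpace M]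
    [ChartedSpace (BergerBiharmonic.Model (2 * m)) M] [IsManifold (𝓡 (2 * m)) ∞ M]
    (g : BergerBiharmonic.Metric (2 * m) M) (F : BergerBiharmonic.Tensor11 (2 * m) M)
    (V : BergerBiharmonic.VField (2 * m) M) (α : M → ℝ)
    (hF : BergerBiharmonic.IsParaKahlerNorden g F)
    (hV : BergerBiharmonic.IsSmoothField V)
    (hVpar : BergerBiharmonic.IsUnitParallel g V)
    (hα : ContMDiff (𝓡 (2 * m)) 𝓘(ℝ, ℝ) ∞ α) (hpos : ∀ x, 0 < α x)
    (hFVα : ∀ x, BergerBiharmonic.dirDeriv α x (BergerBiharmonic.applyField F V x) = 0) :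
    (∀ x : M,
      BergerBiharmonic.bitension g
          (BergerBiharmonic.bergerMetric g F V α hF.smooth hV hα hpos) (id : M → M) x
        = ((1 - 2 * (m : ℝ)) / (2 * α x)) • BergerBiharmonic.bitensionBracket g F V α x)
    ∧ (BergerBiharmonic.IsBiharmonic g
          (BergerBiharmonic.bergerMetric g F V α hF.smooth hV hα hpos) (id : M → M)
        ↔ ∀ x : M, BergerBiharmonic.bitensionBracket g F V α x = 0)
    ∧ (ConnectedSpace M →
        (BergerBiharmonic.IsProperBiharmonic g
            (BergerBiharmonic.bergerMetric g F V α hF.smooth hV hα hpos) (id : M → M)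
          ↔ (¬ ∃ c : ℝ, ∀ x : M, α x = c)
            ∧ ∀ x : M, BergerBiharmonic.bitensionBracket g F V α x = 0)) := by
  have H := BergerBiharmonic.isBergerDeformation_bergerMetric hF hV hVpar hα hpos hFVα
  have key := BergerBiharmonic.bitension_eq_bitensionBracket hα hpos H
  have hbi : BergerBiharmonic.IsBiharmonic g
      (BergerBiharmonic.bergerMetric g F V α hF.smooth hV hα hpos) (id : M → M)
      ↔ ∀ x : M, BergerBiharmonic.bitensionBracket g F V α x = 0 := by
    have hx : ∀ x : M, BergerBiharmonic.bitension g
        (BergerBiharmonic.bergerMetric g F V α hF.smooth hV hα hpos) (id : M → M) x = 0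
        ↔ BergerBiharmonic.bitensionBracket g F V α x = 0 := by
      intro x
      have hm : (1 - 2 * (m : ℝ)) ≠ 0 := by
        rw [sub_ne_zero]
        norm_cast
        omega
      rw [key x]
      exact smul_eq_zero_iff_right (div_ne_zero hm (mul_ne_zero two_ne_zero (hpos x).ne'))
    exact ⟨fun h x => (hx x).mp (h.2 x), fun h => ⟨contMDiff_id, fun x => (hx x).mpr (h x)⟩⟩
  refine ⟨key, hbi, fun hconn => ?_⟩
  rw [BergerBiharmonic.IsProperBiharmonic, hbi, BergerBiharmonic.isHarmonic_iff hα hpos H, and_comm]
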